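/- **Conventions.** A *basis* is a Schauder basis, $[A]$ is the closed linear span of $A$, and supports are taken with respect to the basis of the ambient space. Sequences $(x_k),(x_k')$ are *$C$-equivalent* if $x_k\mapsto x'_k$ extends to an isomorphism $S$ of $[x_k]_k$ onto $[x'_k]_k$ with $\|S\|\|S^{-1}\|\le C$. For $M\subset\mathbb N$ infinite, $(x_m)_{m\in M}$ is enumerated increasingly. **The game.** Let $Y$ be a Banach space with a basis $(y_i)_{i\ge1}$, let $(x_{n,m})_{m}$, $n\in I$, be sequences in $Y$, and let $\tau_k>0$ $(k\ge 1)$. Put $l_0=0$ and $G_0=\emptyset$. On turn $k\ge1$ the first player chooses an integer $i_k\ge l_{k-1}$, finitely many $u^k_j\in Y^*$ with numbers $\rho^k_j>0$ $(j\in F_k)$, and a finite set of vectors $b_j\in[y_i:l_{k-1}<i\le i_k]$ $(j\in J_k)$ such that $|v^{k-1}_r(b)|<\delta^{k-1}_r\|b\|$ for all nonzero $b\in[b_j:j\in J_k]$ and $r\in G_{k-1}$. The second player then chooses a label $n_k\in I$, an integer $l_k>i_k$, a nonempty finite set $M_k\subset\mathbb N$ with $\max M_{k'}<\min M_k$ whenever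 $k'<k$ and $n_{k'}=n_k$, vectors $w^k_m\in[y_i:i_k<i\le l_k]$ $(m\in M_k)$ with successive supports and $\sum_{m\in M_k}\|x_{n_k,m}-w^k_m\|<\tau_k$, where moreover $|u^k_j(x)|<\rho^k_j\|x\|$ for all nonzero $x\in[x_{n_k,m}:m\in M_k]$ and $j\in F_k$, and finitely many $v^k_r\in Y^*$ with numbers $\delta^k_r>0$ $(r\in G_k)$. Put $B=\{b_j:j\in J_k,\ k\in\mathbb N\}$ and $M^{(n)}=\bigcup\{M_k:n_k=n\}$. A basis $(x_m)$ of a Banach space $X$ is *two-player $D$-complementably subsequentially $C$-reproducible* if for every isomorphism $T$ of $X$ onto a subspace of a Banach space $Y$ with a basis and all $\epsilon_k>0$ $(k\ge0)$, the second player has a winning strategy in this game with the single sequence $(Tx_m)_m$ and $\tau_k=\epsilon_k$ $(k\ge1)$, for the outcome that, with $M=\bigcup_kM_k$, $(x_m)_{m\in M}$ is $C$-equivalent to $(x_m)_{m\in\mathbb N}$ and there is a projection $P$ from $[B\cup\{Tx_m:m\in M\}]$ onto $[Tx_m:m\in M]$ with $\|P\|\le\|T\|\|T^{-1}\|D$ and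 $\|Pz\|\le\epsilon_0\|z\|$ for all $z\in[B]$. **Corollary 2.6 (interweave).** For each $n\in\mathbb N$ let $Z_n$ be a Banach space with a two-player $D$-complementably subsequentially $C$-reproducible basis $(z_{n,k})_k$. Let $Y$ be a Banach space with a basis, and for each $n$ let $T_n$ be an isomorphism of $Z_n$ onto a subspace of $Y$ with $\|T_n^{-1}\|\le1$ and $\|T_n\|\le K<\infty$. Let $\epsilon>0$. Then: 1. There are infinite sets $M_n\subset\mathbb N$ and vectors $w_{n,k}\in Y$ $(n\in\mathbb N,\ k\in M_n)$ such that for each $n$ the sequence $(z_{n,k})_{k\in M_n}$ is $C$-equivalent to $(z_{n,k})_{k\in\mathbb N}$; for each $n$ the $w_{n,k}$, $k\in M_n$, are finitely supported with successive supports; $w_{m,j}$ and $w_{n,k}$ are disjointly supported whenever $m\ne n$; $\sum_{n}\sum_{k\in M_n}\|T_nz_{n,k}-w_{n,k}\|\le\epsilon$; and for each $n$ there is a projection $P_n$ from $[T_mz_{m,k}:m\in\mathbb N,\,k\in M_m]$ onto $[T_nz_{n,k}:k\in M_n]$ with $\|P_n\|\le KD$ and $\|P_nz\|\le\epsilon\|z\|$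 for all $z\in[T_mz_{m,k}:m\ne n,\,k\in M_m]$. 2. Moreover the sequences are produced by a two-player game: for all $\tau_k>0$ $(k\ge1)$ the second player has a winning strategy in the game in $Y$ with the sequences $(T_nz_{n,m})_m$, $n\in\mathbb N$, for the outcome that for every $n$ the sequence $(z_{n,k})_{k\in M^{(n)}}$ is $C$-equivalent to $(z_{n,k})_{k\in\mathbb N}$ and there is a projection $P_n$ from $[B\cup\{T_mz_{m,k}:m\in\mathbb N,\ k\in M^{(m)}\}]$ onto $[T_nz_{n,k}:k\in M^{(n)}]$ with $\|P_n\|\le KD$ and $\|P_nz\|\le\epsilon\|z\|$ for all $z\in[B\cup\{T_mz_{m,k}:m\ne n,\ k\in M^{(m)}\}]$. -/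

import Mathlib

universe u v

section Sequences

variable {𝕜 : Type*} [RCLike 𝕜]
variable {X : Type*} [NormedAddCommGroup X] [NormedSpace 𝕜 X]
variable {Y : Type*} [NormedAddCommGroup Y] [NormedSpace 𝕜 Y]

variable (𝕜) in
/-- The closed linear span `[A]` of a set of vectors. -/
def closedSpan (A : Set Y) : Submodule 𝕜 Y :=
  (Submodule.span 𝕜 A).topologicalClosure

variable (𝕜) in
/-- Two sequences are `C`-equivalent: the correspondence `x n ↦ x' n` extends to an isomorphism `S`
of the closed linear spans with `‖S‖ * ‖S⁻¹‖ ≤ C`. -/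
def SeqEquivalent (C : ℝ) (x : ℕ → X) (x' : ℕ → Y) : Prop :=
  ∃ A B : ℝ, 0 < A ∧ 0 < B ∧ A * B ≤ C ∧ ∀ a : ℕ →₀ 𝕜,
    ‖Finsupp.linearCombination 𝕜 x' a‖ ≤ A * ‖Finsupp.linearCombination 𝕜 x a‖ ∧
    ‖Finsupp.linearCombination 𝕜 x a‖ ≤ B * ‖Finsupp.linearCombination 𝕜 x' a‖

/-- `M` is infinite, and the subsequence `(x m)`, `m ∈ M`, enumerated increasingly, is
`C`-equivalent to the whole basis `x`. -/
def SubseqEquivalent (C : ℝ) (x : SchauderBasis 𝕜 X) (M : Set ℕ) : Prop :=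
  ∃ φ : ℕ → ℕ, StrictMono φ ∧ Set.range φ = M ∧ SeqEquivalent 𝕜 C (fun k => x (φ k)) x

/-- The span of the basis vectors `y i` with `a ≤ i < b`. The basis is indexed from `0`; in terms
of an indexing from `1` this is `[y i : a < i ≤ b]`. -/
def blockSpan (y : SchauderBasis 𝕜 Y) (a b : ℕ) : Submodule 𝕜 Y :=
  Submodule.span 𝕜 (y '' Set.Ico a b)

/-- The support of a vector with respect to a basis. -/
def basisSupport (y : SchauderBasis 𝕜 Y) (w : Y) : Set ℕ :=
  {i | y.coord i w ≠ 0}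

/-- The support of `w` lies entirely before the support of `w'`. -/
def Precedes (y : SchauderBasis 𝕜 Y) (w w' : Y) : Prop :=
  ∀ i ∈ basisSupport y w, ∀ j ∈ basisSupport y w', i < j

/-- A sequence of successive, finitely supported blocks of the basis `y`. -/
def IsBlockSequence (y : SchauderBasis 𝕜 Y) (w : ℕ → Y) : Prop :=
  (∀ k, ∃ a b, w k ∈ blockSpan y a b) ∧ ∀ j k, j < k → Precedes y (w j) (w k)

variable (𝕜) in
/-- There is a projection `P` from `[A ∪ V]` onto `[V]` with `‖P‖ ≤ B` and `‖P z‖ ≤ ε ‖z‖` for all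
`z` in `[A]`. -/
def HasSmallProjection (V A : Set Y) (B ε : ℝ) : Prop :=
  ∃ P : closedSpan 𝕜 (A ∪ V) →L[𝕜] Y,
    (∀ z, P z ∈ closedSpan 𝕜 V) ∧
    (∀ z : closedSpan 𝕜 (A ∪ V), (z : Y) ∈ closedSpan 𝕜 V → P z = z) ∧
    ‖P‖ ≤ B ∧
    ∀ z : closedSpan 𝕜 (A ∪ V), (z : Y) ∈ closedSpan 𝕜 A → ‖P z‖ ≤ ε * ‖z‖

end Sequences

section Game

/-- A move of the first player: an integer, finitely many functionals `u` paired with numbers `ρ`,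
and a finite set of vectors. -/
structure FirstMove (𝕜 : Type*) (Y : Type*) [RCLike 𝕜] [NormedAddCommGroup Y]
    [NormedSpace 𝕜 Y] where
  cut : ℕ
  tests : Finset (StrongDual 𝕜 Y × ℝ)
  blocks : Finset Y

/-- A move of the second player: a sequence `label` from which vectors are picked, an integer, the
finite set of indices of the picked vectors, the approximating blocks `approx m` (only those with
`m ∈ indices` matter), and finitely many functionals `v` paired with numbers `δ`. -/
structure SecondMove (ι : Type*) (𝕜 : Type*) (Y : Type*) [RCLike 𝕜] [NormedAddCommGroup Y]
    [NormedSpace 𝕜 Y] where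
  label : ι
  cut : ℕ
  indices : Finset ℕ
  approx : ℕ → Y
  tests : Finset (StrongDual 𝕜 Y × ℝ)

variable {ι : Type*} {𝕜 : Type*} [RCLike 𝕜]
variable {Y : Type*} [NormedAddCommGroup Y] [NormedSpace 𝕜 Y]

/-- The integer chosen by the second player on the previous turn (`0` before the first turn). -/
def prevCut (q : ℕ → SecondMove ι 𝕜 Y) : ℕ → ℕ
  | 0 => 0
  | k + 1 => (q k).cut

/-- The functionals chosen by the second player on the previous turn (none before the first). -/
def prevTests (q : ℕ → SecondMove ι 𝕜 Y) : ℕ → Finset (StrongDual 𝕜 Y × ℝ)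
  | 0 => ∅
  | k + 1 => (q k).tests

/-- The rules for the first player on turn `k`. -/
structure FirstLegal (y : SchauderBasis 𝕜 Y) (p : ℕ → FirstMove 𝕜 Y)
    (q : ℕ → SecondMove ι 𝕜 Y) (k : ℕ) : Prop where
  cut_le : prevCut q k ≤ (p k).cut
  tests_pos : ∀ t ∈ (p k).tests, 0 < t.2
  blocks_mem : ∀ b ∈ (p k).blocks, b ∈ blockSpan y (prevCut q k) (p k).cut
  blocks_small : ∀ b ∈ Submodule.span 𝕜 ((p k).blocks : Set Y), b ≠ 0 →
    ∀ t ∈ prevTests q k, ‖t.1 b‖ < t.2 * ‖b‖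

/-- The rules for the second player on turn `k`, who picks vectors from the sequences `x n`,
`n : ι`, and has to approximate them up to the tolerance `τ k`. -/
structure SecondLegal (y : SchauderBasis 𝕜 Y) (x : ι → ℕ → Y) (τ : ℕ → ℝ)
    (p : ℕ → FirstMove 𝕜 Y) (q : ℕ → SecondMove ι 𝕜 Y) (k : ℕ) : Prop where
  cut_lt : (p k).cut < (q k).cut
  indices_nonempty : (q k).indices.Nonempty
  /-- The indices come after all indices picked earlier from the same sequence. -/
  indices_gt : ∀ j < k, (q j).label = (q k).label →
    ∀ a ∈ (q j).indices, ∀ m ∈ (q k).indices, a < m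
  approx_mem : ∀ m ∈ (q k).indices, (q k).approx m ∈ blockSpan y (p k).cut (q k).cut
  approx_successive : ∀ m ∈ (q k).indices, ∀ m' ∈ (q k).indices, m < m' →
    Precedes y ((q k).approx m) ((q k).approx m')
  approx_close : ∑ m ∈ (q k).indices, ‖x (q k).label m - (q k).approx m‖ < τ k
  picked_small : ∀ b ∈ Submodule.span 𝕜 (x (q k).label '' (q k).indices), b ≠ 0 →
    ∀ t ∈ (p k).tests, ‖t.1 b‖ < t.2 * ‖b‖
  tests_pos : ∀ t ∈ (q k).tests, 0 < t.2

/-- The moves made by a second player who follows `σ`; a strategy `σ` gives the answer to each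
finite list of moves of the first player. -/
def respond (σ : List (FirstMove 𝕜 Y) → SecondMove ι 𝕜 Y) (p : ℕ → FirstMove 𝕜 Y) (k : ℕ) :
    SecondMove ι 𝕜 Y :=
  σ ((List.range (k + 1)).map p)

/-- `σ` is a winning strategy of the second player: as long as the first player obeys the rules,
so does the second player, and if the first player always obeys the rules, then the outcome holds
at the end. -/
def IsWinningStrategy (y : SchauderBasis 𝕜 Y) (x : ι → ℕ → Y) (τ : ℕ → ℝ)
    (Outcome : (ℕ → FirstMove 𝕜 Y) → (ℕ → SecondMove ι 𝕜 Y) → Prop)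
    (σ : List (FirstMove 𝕜 Y) → SecondMove ι 𝕜 Y) : Prop :=
  ∀ p : ℕ → FirstMove 𝕜 Y,
    (∀ k, (∀ j ≤ k, FirstLegal y p (respond σ p) j) → SecondLegal y x τ p (respond σ p) k) ∧
    ((∀ k, FirstLegal y p (respond σ p) k) → Outcome p (respond σ p))

/-- All vectors chosen by the first player in the course of the game. -/
def firstBlocks (p : ℕ → FirstMove 𝕜 Y) : Set Y :=
  {b | ∃ k, b ∈ (p k).blocks}

/-- All indices picked by the second player from the sequence with label `n`. -/
def picked (q : ℕ → SecondMove ι 𝕜 Y) (n : ι) : Set ℕ :=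
  {m | ∃ k, (q k).label = n ∧ m ∈ (q k).indices}

end Game

/-- A basis `x` of a Banach space `X` is two-player `D`-complementably subsequentially
`C`-reproducible: for every isomorphism `T` from `X` onto a subspace `E` of a Banach space `Y` with
a basis `y`, and for all positive numbers `ε k`, the second player has a winning strategy in the
game of picking vectors from the single sequence `T (x m)`. -/
def ComplementablySubseqReproducible {𝕜 : Type*} [RCLike 𝕜] {X : Type u} [NormedAddCommGroup X]
    [NormedSpace 𝕜 X] (D C : ℝ) (x : SchauderBasis 𝕜 X) : Prop :=
  ∀ (Y : Type v) [NormedAddCommGroup Y] [NormedSpace 𝕜 Y] [CompleteSpace Y]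
    (y : SchauderBasis 𝕜 Y) (E : Submodule 𝕜 Y) (T : X ≃L[𝕜] E) (ε : ℕ → ℝ), (∀ k, 0 < ε k) →
    ∃ σ : List (FirstMove 𝕜 Y) → SecondMove Unit 𝕜 Y,
      IsWinningStrategy y (fun _ m => (T (x m) : Y)) (fun k => ε (k + 1))
        (fun p q =>
          SubseqEquivalent C x (picked q ()) ∧
          HasSmallProjection 𝕜 ((fun m => (T (x m) : Y)) '' picked q ()) (firstBlocks p)
            (‖(T : X →L[𝕜] E)‖ * ‖(T.symm : E →L[𝕜] X)‖ * D) (ε 0))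
        σ

open Filter Topology

/-! ### Blocks of a basis, windows, and the sheared basis of a product -/

section Bases

variable {𝕜 : Type*} [RCLike 𝕜]
variable {Y : Type*} [NormedAddCommGroup Y] [NormedSpace 𝕜 Y]
variable {W : Type*} [NormedAddCommGroup W] [NormedSpace 𝕜 W]

/-! For each label `n`, the second player follows a winning strategy of an auxiliary game for `Z n`;
each label occurs on infinitely many turns. In game `n` the first player should submit his main-game
vectors and the vectors picked for the other labels. But picked vectors are not blocks, and
replacing them by nearby blocks would spoil the exact norm bound on the projection.

The remedy is to play the auxiliary games in `Y × W` with the sup norm, where `W` is a copy of `ℓ¹`.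
There `(y i, 0)` and `(J (e t), e t)` alternate as a basis, and the `J (e t)` run through the
normalized vectors `y i` and tails of the `x n m`, each infinitely often. A picked vector then
becomes the first coordinate of a genuine block: its head and its tail are rewritten through vectors
`(J (e t), e t)` with `t` large (`exists_lift`). The second coordinate of this lift is small on the
whole span of the lifts, since the head is small by tests added to the auxiliary game and the tail
can be cut late.

In game `n` its own vectors appear as `(x n m, 0)`, the others as lifts. On the span of all of them
the second coordinate is dominated by the first (`norm_snd_le_norm_fst`), so the first coordinate is
an isometry and the projection descends to `Y` with the same constants
(`HasSmallProjection.fst_image`).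

The rules carry over because every functional chosen in an auxiliary game is passed on, with
geometrically decreasing tolerances `κ`, to the main game and to later auxiliary turns. The vectors
lie in successive windows, so these tolerances add up (`auxFirstLegal`). Conversely `(v, w) ↦ v - J
w` turns auxiliary blocks into blocks of `y` (`secondLegal`).

The first assertion is the game played against a first player who chooses no vectors. -/

theorem basis_coord_self (y : SchauderBasis 𝕜 Y) (i : ℕ) : y.coord i (y i) = 1 := by
  simp [y.ortho]

theorem basis_coord_ne (y : SchauderBasis 𝕜 Y) {i j : ℕ} (h : i ≠ j) : y.coord i (y j) = 0 := by
  simp [y.ortho, h]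

theorem basis_ne_zero (y : SchauderBasis 𝕜 Y) (i : ℕ) : y i ≠ 0 := fun h => by
  simpa [h] using basis_coord_self y i

theorem blockSpan_mono (y : SchauderBasis 𝕜 Y) {a b a' b' : ℕ} (ha : a' ≤ a) (hb : b ≤ b') :
    blockSpan y a b ≤ blockSpan y a' b' :=
  Submodule.span_mono (Set.image_mono (Set.Ico_subset_Ico ha hb))

theorem basis_mem_blockSpan (y : SchauderBasis 𝕜 Y) {a b i : ℕ} (ha : a ≤ i) (hb : i < b) :
    y i ∈ blockSpan y a b :=
  Submodule.subset_span ⟨i, ⟨ha, hb⟩, rfl⟩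

theorem coord_eq_zero_of_mem_blockSpan (y : SchauderBasis 𝕜 Y) {a b i : ℕ} {v : Y}
    (hv : v ∈ blockSpan y a b) (hi : i < a ∨ b ≤ i) : y.coord i v = 0 := by
  have : blockSpan y a b ≤ (y.coord i).toLinearMap.ker := by
    rw [blockSpan, Submodule.span_le]
    rintro _ ⟨j, ⟨h1, h2⟩, rfl⟩
    exact basis_coord_ne y (by omega)
  exact this hv

theorem basisSupport_subset_of_mem_blockSpan (y : SchauderBasis 𝕜 Y) {a b : ℕ} {v : Y}
    (hv : v ∈ blockSpan y a b) : basisSupport y v ⊆ Set.Ico a b := fun i hi => by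
  by_contra h
  refine hi (coord_eq_zero_of_mem_blockSpan y hv ?_)
  simp only [Set.mem_Ico, not_and_or, not_le, not_lt] at h
  exact h

theorem proj_eq_self_of_mem_blockSpan (y : SchauderBasis 𝕜 Y) {a b n : ℕ} {v : Y}
    (hv : v ∈ blockSpan y a b) (hn : b ≤ n) : SchauderBasis.proj y n v = v := by
  have : blockSpan y a b ≤
      (SchauderBasis.proj y n - ContinuousLinearMap.id 𝕜 Y).toLinearMap.ker := by
    rw [blockSpan, Submodule.span_le]
    rintro _ ⟨j, ⟨h1, h2⟩, rfl⟩
    simp only [SetLike.mem_coe, LinearMap.mem_ker, ContinuousLinearMap.coe_coe,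
      sub_apply, SchauderBasis.proj_apply_basis_mem,
      if_pos (show j < n by omega), ContinuousLinearMap.id_apply, sub_self]
  simpa [sub_eq_zero] using this hv

theorem proj_eq_zero_of_mem_blockSpan (y : SchauderBasis 𝕜 Y) {a b n : ℕ} {v : Y}
    (hv : v ∈ blockSpan y a b) (hn : n ≤ a) : SchauderBasis.proj y n v = 0 := by
  rw [SchauderBasis.proj_apply]
  refine Finset.sum_eq_zero fun i hi => ?_
  rw [coord_eq_zero_of_mem_blockSpan y hv (Or.inl ((Finset.mem_range.1 hi).trans_le hn)), zero_smul]

/-- A vector in the span of sets in successive windows of the basis `y` is the sum of its parts in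
these windows, and `A` bounds the norms of the operators which give the parts. -/
def WindowBound (y : SchauderBasis 𝕜 Y) (A : ℝ) : Prop :=
  ∀ (c : ℕ → ℕ) (S : ℕ → Set Y), Monotone c →
    (∀ s, S s ⊆ blockSpan y (c s) (c (s + 1))) → ∃ Q : ℕ → Y →ₗ[𝕜] Y,
      (∀ s, ∀ β ∈ S s, Q s β = β) ∧ (∀ s s', s ≠ s' → ∀ β ∈ S s, Q s' β = 0) ∧
      ∀ β ∈ Submodule.span 𝕜 (⋃ s, S s),
        (∀ s, Q s β ∈ Submodule.span 𝕜 (S s)) ∧ (∀ s, ‖Q s β‖ ≤ A * ‖β‖) ∧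
        ∃ N, ∀ n, N ≤ n → β = ∑ s ∈ Finset.range n, Q s β

theorem exists_windowBound [CompleteSpace Y] (y : SchauderBasis 𝕜 Y) :
    ∃ A : ℝ, 0 < A ∧ WindowBound y A := by
  obtain ⟨C, hC⟩ := SchauderBasis.exists_norm_proj_le y
  have hC0 : 0 ≤ C := (norm_nonneg _).trans (hC 0)
  -- Each part is a difference of two basis projections of norm at most `C`; the extra `1` keeps the
  -- constant positive.
  refine ⟨2 * C + 1, by positivity, fun c S hc hS => ?_⟩
  let Q : ℕ → Y →L[𝕜] Y := fun s => SchauderBasis.proj y (c (s + 1)) - SchauderBasis.proj y (c s)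
  have h1 : ∀ s, ∀ β ∈ S s, Q s β = β := fun s β hβ => by
    change SchauderBasis.proj y (c (s + 1)) β - SchauderBasis.proj y (c s) β = β
    rw [proj_eq_self_of_mem_blockSpan y (hS s hβ) le_rfl,
      proj_eq_zero_of_mem_blockSpan y (hS s hβ) le_rfl, sub_zero]
  have h2 : ∀ s s', s ≠ s' → ∀ β ∈ S s, Q s' β = 0 := fun s s' hss β hβ => by
    change SchauderBasis.proj y (c (s' + 1)) β - SchauderBasis.proj y (c s') β = 0
    rcases lt_or_gt_of_ne hss with h | h
    · rw [proj_eq_self_of_mem_blockSpan y (hS s hβ) (hc (show s + 1 ≤ s' by omega)),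
        proj_eq_self_of_mem_blockSpan y (hS s hβ) (hc (show s + 1 ≤ s' + 1 by omega)), sub_self]
    · rw [proj_eq_zero_of_mem_blockSpan y (hS s hβ) (hc (show s' ≤ s by omega)),
        proj_eq_zero_of_mem_blockSpan y (hS s hβ) (hc (show s' + 1 ≤ s by omega)), sub_self]
  refine ⟨fun s => (Q s).toLinearMap, h1, h2, fun β hβ => ⟨fun s => ?_, fun s => ?_, ?_⟩⟩
  · induction hβ using Submodule.span_induction with
    | mem x hx =>
      obtain ⟨s', hs'⟩ := Set.mem_iUnion.1 hx
      by_cases h : s' = s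
      · subst h
        rw [ContinuousLinearMap.coe_coe, h1 _ _ hs']
        exact Submodule.subset_span hs'
      · rw [ContinuousLinearMap.coe_coe, h2 _ _ h _ hs']
        exact zero_mem _
    | zero => simp
    | add x x' _ _ hx hx' => rw [map_add]; exact add_mem hx hx'
    | smul r x _ hx => rw [map_smul]; exact Submodule.smul_mem _ _ hx
  · refine ((Q s).le_opNorm β).trans (mul_le_mul_of_nonneg_right ?_ (norm_nonneg _))
    refine (norm_sub_le _ _).trans ?_
    linarith [hC (c (s + 1)), hC (c s)]
  · induction hβ using Submodule.span_induction with
    | mem x hx =>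
      obtain ⟨s', hs'⟩ := Set.mem_iUnion.1 hx
      refine ⟨s' + 1, fun n hn => ?_⟩
      change x = ∑ s ∈ Finset.range n, Q s x
      rw [Finset.sum_eq_single_of_mem s' (Finset.mem_range.2 hn)
        fun s _ hs => h2 s' s hs.symm x hs']
      exact (h1 _ _ hs').symm
    | zero => exact ⟨0, fun n _ => by simp⟩
    | add x x' _ _ hx hx' =>
      obtain ⟨N, hN⟩ := hx
      obtain ⟨N', hN'⟩ := hx'
      refine ⟨max N N', fun n hn => ?_⟩
      simp only [map_add, Finset.sum_add_distrib]
      rw [← hN n (le_of_max_le_left hn), ← hN' n (le_of_max_le_right hn)]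
    | smul r x _ hx =>
      obtain ⟨N, hN⟩ := hx
      refine ⟨N, fun n hn => ?_⟩
      simp only [map_smul, ← Finset.smul_sum]
      rw [← hN n hn]

theorem sum_range_interleave {M : Type*} [AddCommMonoid M] (f : ℕ → M) (n : ℕ) :
    ∑ s ∈ Finset.range n, f s =
      ∑ i ∈ Finset.range ((n + 1) / 2), f (2 * i) + ∑ t ∈ Finset.range (n / 2), f (2 * t + 1) := by
  induction n with
  | zero => simp
  | succ n ih =>
    rw [Finset.sum_range_succ, ih]
    rcases Nat.even_or_odd' n with ⟨k, rfl | rfl⟩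
    · rw [show (2 * k + 1 + 1) / 2 = k + 1 by omega, show (2 * k + 1) / 2 = k by omega,
        show 2 * k / 2 = k by omega, Finset.sum_range_succ (fun i => f (2 * i))]
      abel
    · rw [show (2 * k + 1 + 1 + 1) / 2 = k + 1 by omega, show (2 * k + 1 + 1) / 2 = k + 1 by omega,
        show (2 * k + 1) / 2 = k by omega, Finset.sum_range_succ (fun i => f (2 * i + 1))]
      abel

/-- Given a bounded operator `J : W → Y`, the vectors `(y i, 0)` and `(J (e t), e t)`, taken
alternately, form a basis of `Y × W`. -/
noncomputable def interleavedBasis (y : SchauderBasis 𝕜 Y) (e : SchauderBasis 𝕜 W)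
    (J : W →L[𝕜] Y) : SchauderBasis 𝕜 (Y × W) where
  basis s := if s % 2 = 0 then (y (s / 2), 0) else (J (e (s / 2)), e (s / 2))
  coord s := if s % 2 = 0 then
      (y.coord (s / 2)).comp (ContinuousLinearMap.fst 𝕜 Y W - J.comp (.snd 𝕜 Y W))
    else (e.coord (s / 2)).comp (.snd 𝕜 Y W)
  ortho s s' := by
    by_cases h : s = s'
    · subst h
      by_cases hs : s % 2 = 0 <;> simp [hs, basis_coord_self]
    · simp only [Pi.single_apply, if_neg h]
      by_cases hs : s % 2 = 0 <;> by_cases hs' : s' % 2 = 0 <;> simp only [hs, hs', if_true, if_false]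
      · simpa using basis_coord_ne y (by omega)
      · simp
      · simp
      · simpa using basis_coord_ne e (by omega)
  expansion v := by
    rw [HasSum, SummationFilter.conditional_filter_eq_map_range, tendsto_map'_iff]
    -- Of the first `n` indices, `(n + 1) / 2` are even and `n / 2` are odd.
    have h1 : Tendsto (fun n : ℕ => (n + 1) / 2) atTop atTop :=
      tendsto_atTop_mono (f := fun n : ℕ => n / 2) (fun n => Nat.div_le_div_right n.le_succ)
        (Nat.tendsto_div_const_atTop two_ne_zero)
    have h2 : Tendsto (fun n : ℕ => n / 2) atTop atTop :=
      Nat.tendsto_div_const_atTop two_ne_zero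
    have hy := (SchauderBasis.tendsto_proj y (v.1 - J v.2)).comp h1
    have he := (SchauderBasis.tendsto_proj e v.2).comp h2
    have hl := (((ContinuousLinearMap.inl 𝕜 Y W).continuous.tendsto _).comp hy).add
      (((J.prod (.id 𝕜 W)).continuous.tendsto _).comp he)
    convert hl using 1
    · ext1 n
      simp only [Function.comp_apply]
      rw [sum_range_interleave]
      congr 1
      · rw [SchauderBasis.proj_apply, map_sum]
        refine Finset.sum_congr rfl fun i _ => ?_
        simp
      · rw [SchauderBasis.proj_apply, map_sum]
        refine Finset.sum_congr rfl fun i _ => ?_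
        have h4 : (2 * i + 1) / 2 = i := by omega
        simp [h4]
    · simp

variable (y : SchauderBasis 𝕜 Y) (e : SchauderBasis 𝕜 W) (J : W →L[𝕜] Y)

theorem interleavedBasis_even (i : ℕ) : interleavedBasis y e J (2 * i) = (y i, 0) := by
  simp [interleavedBasis]

theorem interleavedBasis_odd (t : ℕ) : interleavedBasis y e J (2 * t + 1) = (J (e t), e t) := by
  simp only [interleavedBasis]
  rw [if_neg (by omega), show (2 * t + 1) / 2 = t by omega]

theorem interleavedBasis_coord_even (i : ℕ) (v : Y × W) :
    (interleavedBasis y e J).coord (2 * i) v = y.coord i (v.1 - J v.2) := by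
  simp [interleavedBasis]

theorem inl_mem_blockSpan {a b : ℕ} {v : Y} (hv : v ∈ blockSpan y a b) :
    (v, (0 : W)) ∈ blockSpan (interleavedBasis y e J) (2 * a) (2 * b) := by
  have : blockSpan y a b ≤ (blockSpan (interleavedBasis y e J) (2 * a) (2 * b)).comap
      (LinearMap.inl 𝕜 Y W) := by
    rw [blockSpan, Submodule.span_le]
    rintro _ ⟨i, ⟨h1, h2⟩, rfl⟩
    change (y i, (0 : W)) ∈ blockSpan (interleavedBasis y e J) (2 * a) (2 * b)
    rw [← interleavedBasis_even y e J]
    exact basis_mem_blockSpan _ (by omega) (by omega)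
  exact this hv

/-- The shear `(v, w) ↦ v - J w` sends the even basis vectors to the `y i` and kills the odd ones.
It carries the approximating blocks from an auxiliary game back to `Y`. -/
theorem unshear_mem_blockSpan {a b q : ℕ} {v : Y × W}
    (hv : v ∈ blockSpan (interleavedBasis y e J) (2 * a) q) (hq : q ≤ 2 * b) :
    v.1 - J v.2 ∈ blockSpan y a b := by
  have : blockSpan (interleavedBasis y e J) (2 * a) q ≤ (blockSpan y a b).comap
      (ContinuousLinearMap.fst 𝕜 Y W - J.comp (.snd 𝕜 Y W)).toLinearMap := by
    rw [blockSpan, Submodule.span_le]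
    rintro _ ⟨s, ⟨h1, h2⟩, rfl⟩
    change (interleavedBasis y e J s).1 - J (interleavedBasis y e J s).2 ∈ blockSpan y a b
    rcases Nat.even_or_odd' s with ⟨i, rfl | rfl⟩
    · rw [interleavedBasis_even, map_zero, sub_zero]
      exact basis_mem_blockSpan _ (by omega) (by omega)
    · rw [interleavedBasis_odd, sub_self]
      exact zero_mem _
  exact this hv

end Bases

/-! ### A copy of `ℓ¹` with operators onto prescribed bounded sequences -/

section Absolute

variable {𝕜 : Type*} [RCLike 𝕜]

/-- The space `ℓ¹`, realised in the universe of a given space with a basis. -/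
theorem exists_absolute_basis {Y : Type v} [NormedAddCommGroup Y] [NormedSpace 𝕜 Y]
    [CompleteSpace Y] (y : SchauderBasis 𝕜 Y) :
    ∃ (W : Type v) (_ : NormedAddCommGroup W) (_ : NormedSpace 𝕜 W) (_ : CompleteSpace W)
      (e : SchauderBasis 𝕜 W) (c : ℝ), (∀ t, ‖e t‖ ≤ c) ∧
      ∀ a : ℕ → Y, (∀ t, ‖a t‖ ≤ 1) → ∃ J : W →L[𝕜] Y, ∀ t, J (e t) = a t := by
  -- A line in `Y` replaces the scalar field, so that `W` lives in the universe of `Y`, the one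
  -- covered by the reproducibility hypothesis.
  let L : Submodule 𝕜 Y := Submodule.span 𝕜 {y 0}
  have : CompleteSpace L := FiniteDimensional.complete 𝕜 L
  let g : StrongDual 𝕜 L := (y.coord 0).comp L.subtypeL
  let u : L := ⟨y 0, Submodule.mem_span_singleton_self _⟩
  have hgu : g u = 1 := basis_coord_self y 0
  have hg : ∀ w : L, g w • u = w := by
    rintro ⟨w, hw⟩
    obtain ⟨r, rfl⟩ := Submodule.mem_span_singleton.1 hw
    ext
    simp [g, u, basis_coord_self]
  let W := lp (fun _ : ℕ => L) 1
  let ev : ℕ → W →L[𝕜] L := fun t => lp.evalCLM 𝕜 (fun _ : ℕ => L) 1 t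
  have hev : ∀ t (w : W), ev t w = w t := fun t w => rfl
  have hsum : ∀ w : W, HasSum (fun t => ‖w t‖) ‖w‖ := fun w => by
    simpa using lp.hasSum_norm (p := 1) (by simp) w
  let e : SchauderBasis 𝕜 W :=
    { basis := fun t => lp.single 1 t u
      coord := fun t => g.comp (ev t)
      ortho := fun i j => by
        by_cases h : i = j
        · subst h
          simp [hev, hgu]
        · simp [hev, h]
      expansion := fun w => by
        have h := (lp.hasSum_single (p := 1) (by simp) w).tendsto_sum_nat
        rw [HasSum, SummationFilter.conditional_filter_eq_map_range, tendsto_map'_iff]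
        convert h using 1
        ext1 n
        refine Finset.sum_congr rfl fun t _ => ?_
        rw [← lp.single_smul]
        congr 1
        exact hg _ }
  refine ⟨W, inferInstance, inferInstance, inferInstance, e, ‖u‖, fun t => ?_, fun a ha => ?_⟩
  · exact (lp.norm_single (E := fun _ : ℕ => L) (p := 1) zero_lt_one t u).le
  have hle : ∀ (w : W) t, ‖e.coord t w • a t‖ ≤ ‖g‖ * ‖w t‖ := fun w t => by
    rw [norm_smul]
    calc ‖e.coord t w‖ * ‖a t‖ ≤ ‖e.coord t w‖ * 1 :=
          mul_le_mul_of_nonneg_left (ha t) (norm_nonneg _)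
      _ = ‖g (w t)‖ := mul_one _
      _ ≤ ‖g‖ * ‖w t‖ := g.le_opNorm _
  have hs : ∀ w : W, Summable fun t => e.coord t w • a t := fun w =>
    Summable.of_norm_bounded ((hsum w).summable.mul_left _) (hle w)
  let J₀ : W →ₗ[𝕜] Y :=
    { toFun := fun w => ∑' t, e.coord t w • a t
      map_add' := fun w w' => by
        simp only [map_add, add_smul]
        exact (hs w).tsum_add (hs w')
      map_smul' := fun r w => by
        simp only [map_smul, smul_assoc]
        exact (hs w).tsum_const_smul r }
  refine ⟨J₀.mkContinuous ‖g‖ fun w => ?_, fun t => ?_⟩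
  · exact tsum_of_norm_bounded ((hsum w).mul_left _) (hle w)
  · change ∑' s, e.coord s (e t) • a s = a t
    rw [tsum_eq_single t fun s hs => by rw [basis_coord_ne e hs, zero_smul], basis_coord_self,
      one_smul]

end Absolute

/-! ### Lifting picked vectors to blocks of the product -/

section Lift

variable {𝕜 : Type*} [RCLike 𝕜]
variable {Y : Type*} [NormedAddCommGroup Y] [NormedSpace 𝕜 Y]

/-- Countably many vectors can be listed, up to normalization, so that each of them appears
infinitely often. -/
theorem exists_recurrent_normalized {S : Set Y} (hS : S.Countable) (hne : S.Nonempty) :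
    ∃ a : ℕ → Y, (∀ t, ‖a t‖ ≤ 1) ∧
      ∀ v ∈ S, ∀ N, ∃ t, N ≤ t ∧ (‖v‖ : 𝕜) • a t = v := by
  obtain ⟨f, rfl⟩ := hS.exists_eq_range hne
  -- The first component of unpairing takes each value infinitely often; a zero vector stays zero
  -- because `0⁻¹ = 0`.
  refine ⟨fun t => (‖f (Nat.unpair t).1‖⁻¹ : 𝕜) • f (Nat.unpair t).1, fun t => ?_, ?_⟩
  · rw [norm_smul, norm_inv, RCLike.norm_ofReal, abs_norm]
    exact inv_mul_le_one
  · rintro _ ⟨i, rfl⟩ N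
    refine ⟨Nat.pair i N, Nat.right_le_pair i N, ?_⟩
    simp only [Nat.unpair_pair]
    by_cases h : f i = 0
    · simp [h]
    · rw [smul_smul, mul_inv_cancel₀ (by simpa using h), one_smul]

/-- Vectors `x m` which are almost supported after `i` are the first components of blocks in the
product space whose second components are small. -/
theorem exists_lift {W : Type*} [NormedAddCommGroup W] [NormedSpace 𝕜 W]
    (y : SchauderBasis 𝕜 Y) (e : SchauderBasis 𝕜 W) (J : W →L[𝕜] Y) {c : ℝ}
    (hc : ∀ t, ‖e t‖ ≤ c) (x : ℕ → Y) (f : ℕ → ℝ)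
    (hf : ∀ (s : Finset ℕ) (r : ℕ → 𝕜), ∀ m ∈ s, ‖r m‖ ≤ f m * ‖∑ j ∈ s, r j • x j‖)
    (hhead : ∀ i N, ∃ t, N ≤ t ∧ (‖y i‖ : 𝕜) • J (e t) = y i)
    (htail : ∀ m n N, ∃ t, N ≤ t ∧
      (‖x m - SchauderBasis.proj y n (x m)‖ : 𝕜) • J (e t) = x m - SchauderBasis.proj y n (x m))
    (i : ℕ) (η : ℝ) (hη : 0 < η) :
    ∃ ρ : ℝ, 0 < ρ ∧ ∀ M : Finset ℕ,
      (∀ b ∈ Submodule.span 𝕜 (x '' M), b ≠ 0 → ∀ j < i, ‖y.coord j b‖ < ρ * ‖b‖) →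
      ∃ (ψ : ℕ → Y × W) (l : ℕ),
        (∀ m ∈ M, (ψ m).1 = x m ∧ ψ m ∈ blockSpan (interleavedBasis y e J) (2 * i) (2 * l)) ∧
        ∀ β ∈ Submodule.span 𝕜 (ψ '' M), ‖β.2‖ ≤ η * ‖β.1‖ := by
  have hc0 : 0 ≤ c := (norm_nonneg _).trans (hc 0)
  have hY0 : 0 ≤ ∑ j ∈ Finset.range i, ‖y j‖ := Finset.sum_nonneg fun _ _ => norm_nonneg _
  set H : ℝ := c * ∑ j ∈ Finset.range i, ‖y j‖ with hH
  have hH0 : 0 ≤ H := mul_nonneg hc0 hY0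
  -- Half of `η` is spent on the heads, whose rewriting costs at most the factor `H`; the other half
  -- is for the tails.
  refine ⟨η / (2 * (H + 1)), by positivity, fun M hM => ?_⟩
  choose th hth1 hth2 using fun j => hhead j i
  -- The tail is cut so late that, after multiplication by the bound `f m` on the coefficients, the
  -- tails share `η / 2`.
  have hL : ∀ m, ∃ n, i ≤ n ∧
      |f m| * (‖x m - SchauderBasis.proj y n (x m)‖ * c) ≤ η / (2 * (M.card + 1)) := fun m => by
    have h1 : Tendsto (fun n => |f m| * (‖x m - SchauderBasis.proj y n (x m)‖ * c)) atTop (𝓝 0) := by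
      have h2 := ((tendsto_const_nhds (x := x m)).sub (SchauderBasis.tendsto_proj y (x m))).norm
      simpa using (h2.mul_const c).const_mul |f m|
    obtain ⟨n, hn⟩ := ((h1.eventually (gt_mem_nhds (show 0 < η / (2 * (M.card + 1)) by
      positivity))).and (eventually_ge_atTop i)).exists
    exact ⟨n, hn.2, hn.1.le⟩
  choose n hn1 hn2 using hL
  choose tt htt1 htt2 using fun m => htail m (n m) i
  let θh : Y →L[𝕜] W := ∑ j ∈ Finset.range i, (y.coord j).smulRight ((‖y j‖ : 𝕜) • e (th j))
  let θt : ℕ → W := fun m => (‖x m - SchauderBasis.proj y (n m) (x m)‖ : 𝕜) • e (tt m)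
  have hθh : ∀ v, θh v = ∑ j ∈ Finset.range i, y.coord j v • ((‖y j‖ : 𝕜) • e (th j)) :=
    fun v => by simp [θh]
  refine ⟨fun m => (x m, θh (x m) + θt m),
    (∑ j ∈ Finset.range i, (th j + 1)) + ∑ m ∈ M, (tt m + 1 + n m), fun m hm => ⟨rfl, ?_⟩, ?_⟩
  · set l := (∑ j ∈ Finset.range i, (th j + 1)) + ∑ m ∈ M, (tt m + 1 + n m) with hl
    have hth : ∀ j ∈ Finset.range i, th j < l := fun j hj => by
      have := Finset.single_le_sum (f := fun j => th j + 1) (fun _ _ => Nat.zero_le _) hj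
      omega
    have hm' := Finset.single_le_sum (f := fun m => tt m + 1 + n m) (fun _ _ => Nat.zero_le _) hm
    -- Head and tail use odd basis vectors beyond position `2 * i`; only the middle coordinates keep
    -- their even ones. Hence the lift is an exact block with first coordinate `x m`.
    have hsplit : (x m, θh (x m) + θt m) =
        ∑ j ∈ Finset.range i, y.coord j (x m) • (‖y j‖ : 𝕜) •
            interleavedBasis y e J (2 * th j + 1) +
          (‖x m - SchauderBasis.proj y (n m) (x m)‖ : 𝕜) •
            interleavedBasis y e J (2 * tt m + 1) +
          ∑ j ∈ Finset.Ico i (n m), y.coord j (x m) • interleavedBasis y e J (2 * j) := by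
      simp only [interleavedBasis_odd, interleavedBasis_even]
      ext
      · simp only [Prod.fst_add, Prod.fst_sum, Prod.smul_fst, hth2, htt2]
        rw [SchauderBasis.proj_apply, ← Finset.sum_range_add_sum_Ico _ (hn1 m)]
        abel
      · simp only [Prod.snd_add, Prod.snd_sum, Prod.smul_snd, hθh, smul_zero,
          Finset.sum_const_zero, add_zero]
        rfl
    beta_reduce
    rw [hsplit]
    refine add_mem (add_mem (sum_mem fun j hj => ?_) ?_) (sum_mem fun j hj => ?_)
    · refine Submodule.smul_mem _ _ (Submodule.smul_mem _ _ (basis_mem_blockSpan _ ?_ ?_))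
      · have := hth1 j
        omega
      · have := hth j hj
        omega
    · refine Submodule.smul_mem _ _ (basis_mem_blockSpan _ ?_ ?_)
      · have := htt1 m
        omega
      · omega
    · rw [Finset.mem_Ico] at hj
      exact Submodule.smul_mem _ _ (basis_mem_blockSpan _ (by omega) (by omega))
  · intro β hβ
    obtain ⟨r, rfl⟩ := (Submodule.mem_span_image_finset_iff_exists_fun' 𝕜).1 hβ
    set b := ∑ m ∈ M, r m • x m with hb
    have h1 : (∑ m ∈ M, r m • (x m, θh (x m) + θt m)).1 = b := by
      simp [Prod.fst_sum, hb]
    have h2 : (∑ m ∈ M, r m • (x m, θh (x m) + θt m)).2 = θh b + ∑ m ∈ M, r m • θt m := by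
      simp [Prod.snd_sum, hb, Finset.sum_add_distrib]
    rw [h1, h2]
    have hbmem : b ∈ Submodule.span 𝕜 (x '' M) :=
      sum_mem fun m hm => Submodule.smul_mem _ _ (Submodule.subset_span ⟨m, hm, rfl⟩)
    have hcoord : ∀ j < i, ‖y.coord j b‖ ≤ η / (2 * (H + 1)) * ‖b‖ := fun j hj => by
      by_cases h0 : b = 0
      · simp [h0]
      · exact (hM b hbmem h0 j hj).le
    have hA : ‖θh b‖ ≤ η / 2 * ‖b‖ := by
      rw [hθh]
      calc _ ≤ ∑ j ∈ Finset.range i, η / (2 * (H + 1)) * ‖b‖ * (‖y j‖ * c) := by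
            refine norm_sum_le_of_le _ fun j hj => ?_
            rw [norm_smul, norm_smul, RCLike.norm_ofReal, abs_norm]
            exact mul_le_mul (hcoord j (Finset.mem_range.1 hj))
              (mul_le_mul_of_nonneg_left (hc _) (norm_nonneg _)) (by positivity) (by positivity)
        _ = η / (2 * (H + 1)) * ‖b‖ * H := by
            rw [← Finset.mul_sum, ← Finset.sum_mul, hH, mul_comm c]
        _ = η / 2 * ‖b‖ * (H / (H + 1)) := by field_simp
        _ ≤ η / 2 * ‖b‖ * 1 :=
            mul_le_mul_of_nonneg_left ((div_le_one (by positivity)).2 (by linarith)) (by positivity)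
        _ = η / 2 * ‖b‖ := mul_one _
    have hB : ‖∑ m ∈ M, r m • θt m‖ ≤ η / 2 * ‖b‖ := by
      calc _ ≤ ∑ m ∈ M, η / (2 * (M.card + 1)) * ‖b‖ := by
            refine norm_sum_le_of_le _ fun m hm => ?_
            rw [norm_smul]
            have h3 : ‖θt m‖ ≤ ‖x m - SchauderBasis.proj y (n m) (x m)‖ * c := by
              rw [norm_smul, RCLike.norm_ofReal, abs_norm]
              exact mul_le_mul_of_nonneg_left (hc _) (norm_nonneg _)
            calc ‖r m‖ * ‖θt m‖ ≤
                  (|f m| * ‖b‖) * (‖x m - SchauderBasis.proj y (n m) (x m)‖ * c) :=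
                  mul_le_mul ((hf M r m hm).trans
                    (mul_le_mul_of_nonneg_right (le_abs_self _) (norm_nonneg _))) h3
                    (norm_nonneg _) (by positivity)
              _ = (|f m| * (‖x m - SchauderBasis.proj y (n m) (x m)‖ * c)) * ‖b‖ := by ring
              _ ≤ _ := mul_le_mul_of_nonneg_right (hn2 m) (norm_nonneg _)
        _ = η / 2 * ‖b‖ * (M.card / (M.card + 1)) := by
            rw [Finset.sum_const, nsmul_eq_mul]
            field_simp
        _ ≤ η / 2 * ‖b‖ * 1 :=
            mul_le_mul_of_nonneg_left ((div_le_one (by positivity)).2 (by linarith)) (by positivity)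
        _ = η / 2 * ‖b‖ := mul_one _
    calc _ ≤ η / 2 * ‖b‖ + η / 2 * ‖b‖ := norm_add_le_of_le hA hB
      _ = η * ‖b‖ := by ring

end Lift

/-! ### Windows, turns with a given label, and the interleaved play -/

section Play

variable {𝕜 : Type*} [RCLike 𝕜]
variable {Y : Type*} [NormedAddCommGroup Y] [NormedSpace 𝕜 Y]
variable {W : Type*} [NormedAddCommGroup W] [NormedSpace 𝕜 W]

/-- In the middle of a game only finitely many windows are known to be well placed. Freezing the
positions after `N` and emptying the later windows reduces this to the infinite case. -/
theorem WindowBound.exists_parts {y : SchauderBasis 𝕜 Y} {A : ℝ} (hA : WindowBound y A) (N : ℕ)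
    (c : ℕ → ℕ) (S : ℕ → Set Y) (hc : ∀ s < N, c s ≤ c (s + 1))
    (hS : ∀ s < N, S s ⊆ blockSpan y (c s) (c (s + 1))) {β : Y}
    (hβ : β ∈ Submodule.span 𝕜 (⋃ s < N, S s)) :
    ∃ γ : ℕ → Y, β = ∑ s ∈ Finset.range N, γ s ∧ (∀ s < N, γ s ∈ Submodule.span 𝕜 (S s)) ∧
      ∀ s, ‖γ s‖ ≤ A * ‖β‖ := by
  obtain ⟨Q, -, -, hQ⟩ := hA (fun s => c (min s N)) (fun s => {b | s < N ∧ b ∈ S s})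
    (monotone_nat_of_le_succ fun s => by
      rcases lt_or_ge s N with h | h
      · rw [min_eq_left h.le, min_eq_left (Nat.succ_le_of_lt h)]
        exact hc s h
      · rw [min_eq_right h, min_eq_right (h.trans s.le_succ)])
    (fun s b hb => by
      rw [min_eq_left hb.1.le, min_eq_left (Nat.succ_le_of_lt hb.1)]
      exact hS s hb.1 hb.2)
  obtain ⟨h1, h2, n, hn⟩ := hQ β (by
    refine Submodule.span_mono ?_ hβ
    intro b hb
    simp only [Set.mem_iUnion] at hb ⊢
    obtain ⟨s, hs, hb⟩ := hb
    exact ⟨s, hs, hb⟩)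
  refine ⟨fun s => Q s β, ?_, fun s _ => Submodule.span_mono (fun b hb => hb.2) (h1 s), h2⟩
  refine (hn (max n N) (le_max_left _ _)).trans (Finset.sum_subset
    (Finset.range_subset_range.2 (le_max_right _ _)) fun s _ hs => ?_).symm
  have h3 := h1 s
  rw [Finset.mem_range] at hs
  simpa [hs] using h3

/-- No turn from `j` on and before `k` has the label of turn `k`. -/
def Fresh (lab : ℕ → ℕ) (j k : ℕ) : Prop :=
  ∀ i, j ≤ i → i < k → lab i ≠ lab k

/-- The `i`-th turn with label `n`. -/
noncomputable def turn (lab : ℕ → ℕ) (n i : ℕ) : ℕ := Nat.nth (fun k => lab k = n) i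

/-- The number of turns with label `n` before turn `k`. -/
def turnCount (lab : ℕ → ℕ) (n k : ℕ) : ℕ := Nat.count (fun k => lab k = n) k

theorem turn_turnCount (lab : ℕ → ℕ) (k : ℕ) : turn lab (lab k) (turnCount lab (lab k) k) = k :=
  Nat.nth_count (p := fun j => lab j = lab k) rfl

theorem turn_lt {lab : ℕ → ℕ} {n i k : ℕ} (h : i < turnCount lab n k) : turn lab n i < k :=
  Nat.nth_lt_of_lt_count h

theorem turnCount_turn {lab : ℕ → ℕ} {n i k : ℕ} (h : i < turnCount lab n k) :
    turnCount lab n (turn lab n i) = i :=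
  Nat.count_nth fun hf => h.trans_le (Nat.count_le_card hf k)

theorem lab_turn {lab : ℕ → ℕ} {n i k : ℕ} (h : i < turnCount lab n k) : lab (turn lab n i) = n :=
  Nat.nth_mem (p := fun k => lab k = n) i fun hf => h.trans_le (Nat.count_le_card hf k)

theorem turnCount_lt {lab : ℕ → ℕ} {j k : ℕ} (h : j < k) (hl : lab j = lab k) :
    turnCount lab (lab k) j < turnCount lab (lab k) k :=
  Nat.count_strict_mono (p := fun i => lab i = lab k) hl h

/-- Used to recognize the part of the main history with label `n` as the history of the auxiliary
game `n`. -/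
theorem map_filter_range (lab : ℕ → ℕ) (n k : ℕ) {α : Type*} (f : ℕ → α) :
    ((List.range k).filter (fun j => lab j = n)).map f =
      (List.range (turnCount lab n k)).map (fun i => f (turn lab n i)) := by
  induction k with
  | zero => simp [turnCount]
  | succ k ih =>
    rw [List.range_succ, List.filter_append, List.map_append, ih]
    simp only [turnCount, Nat.count_succ]
    by_cases h : lab k = n
    · subst h
      simp only [if_true, List.range_succ, List.map_append]
      congr 1
      simpa [turnCount] using congrArg f (turn_turnCount lab k).symm
    · simp [h]

/-- A run of the game in `Y` with labels `lab k`, in which the second player answers by means of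
auxiliary games in `Y × W`, one for each label: `P k` and `Q k` are the moves on turn `k` in the
auxiliary game with label `lab k`. The vectors `ψ k m` stand for the picked vectors `x (lab k) m`
in the other auxiliary games. -/
structure InterleavedPlay (y : SchauderBasis 𝕜 Y) (e : SchauderBasis 𝕜 W) (J : W →L[𝕜] Y)
    (lab : ℕ → ℕ) (x : ℕ → ℕ → Y) (κ η : ℕ → ℝ)
    (p : ℕ → FirstMove 𝕜 Y) (q : ℕ → SecondMove ℕ 𝕜 Y)
    (P : ℕ → FirstMove 𝕜 (Y × W)) (Q : ℕ → SecondMove Unit 𝕜 (Y × W)) (ψ : ℕ → ℕ → Y × W) :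
    Prop where
  label : ∀ k, (q k).label = lab k
  cut_lt : ∀ k, (p k).cut < (q k).cut
  cut_le : ∀ k, (Q k).cut ≤ 2 * (q k).cut
  indices : ∀ k, (q k).indices = (Q k).indices
  approx : ∀ k m, (q k).approx m = ((Q k).approx m).1 - J ((Q k).approx m).2
  -- All earlier auxiliary functionals are repeated on every turn, since the rules bind the first
  -- player only to the tests of the preceding turn.
  mem_tests : ∀ k t, t ∈ (q k).tests ↔ ∃ j ≤ k, ∃ t' ∈ (Q j).tests,
    t = (t'.1.comp (.inl 𝕜 Y W), t'.2 * κ (k + 1))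
  aux_cut : ∀ k, (P k).cut = 2 * (p k).cut
  aux_tests_pos : ∀ k, (∀ t ∈ (p k).tests, 0 < t.2) → (∀ j < k, ∀ t ∈ (Q j).tests, 0 < t.2) →
    ∀ t ∈ (P k).tests, 0 < t.2
  aux_tests_first : ∀ k, ∀ t ∈ (p k).tests, (t.1.comp (.fst 𝕜 Y W), t.2) ∈ (P k).tests
  aux_tests_prev : ∀ k, ∀ j < k, ∀ t ∈ (Q j).tests,
    ((t.1.comp (.inl 𝕜 Y W)).comp (.fst 𝕜 Y W), t.2 * κ k) ∈ (P k).tests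
  -- Freshness selects what has appeared since the last turn with the same label, so nothing enters
  -- before the preceding auxiliary answer.
  mem_aux_blocks : ∀ k b, b ∈ (P k).blocks ↔ ∃ j ≤ k, Fresh lab j k ∧
    ((∃ b' ∈ (p j).blocks, b = (b', 0)) ∨ (j < k ∧ ∃ m ∈ (Q j).indices, b = ψ j m))
  lift : ∀ k, (∀ b ∈ Submodule.span 𝕜 (x (lab k) '' (Q k).indices), b ≠ 0 →
      ∀ t ∈ (P k).tests, ‖t.1 (b, 0)‖ < t.2 * ‖b‖) →
    (∀ m ∈ (Q k).indices, (ψ k m).1 = x (lab k) m ∧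
      ψ k m ∈ blockSpan (interleavedBasis y e J) (2 * (p k).cut) (2 * (q k).cut)) ∧
    ∀ β ∈ Submodule.span 𝕜 (ψ k '' (Q k).indices), ‖β.2‖ ≤ η k * ‖β.1‖
  eta_nonneg : ∀ k, 0 ≤ η k
  eta_le : ∀ k, η k ≤ κ k
  eta_tests : ∀ k, ∀ j < k, ∀ t ∈ (Q j).tests, 0 < t.2 → ‖t.1‖ * η k ≤ t.2 * κ k

/-- The vectors of the window `s`: those of the first player on turn `s / 2` for even `s`, and the
lifts of those picked on turn `s / 2` for odd `s`. -/
def windowSet (p : ℕ → FirstMove 𝕜 Y) (Q : ℕ → SecondMove Unit 𝕜 (Y × W))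
    (ψ : ℕ → ℕ → Y × W) (s : ℕ) : Set (Y × W) :=
  if s % 2 = 0 then (fun b => (b, 0)) '' ((p (s / 2)).blocks : Set Y)
  else ψ (s / 2) '' (Q (s / 2)).indices

/-- The position, in the interleaved basis, where the window `s` begins. -/
def windowStart (p : ℕ → FirstMove 𝕜 Y) (q : ℕ → SecondMove ℕ 𝕜 Y) (s : ℕ) : ℕ :=
  if s % 2 = 0 then 2 * prevCut q (s / 2) else 2 * (p (s / 2)).cut

theorem windowSet_even (p : ℕ → FirstMove 𝕜 Y) (Q : ℕ → SecondMove Unit 𝕜 (Y × W))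
    (ψ : ℕ → ℕ → Y × W) (j : ℕ) :
    windowSet p Q ψ (2 * j) = (fun b => (b, 0)) '' ((p j).blocks : Set Y) := by
  simp [windowSet]

theorem windowSet_odd (p : ℕ → FirstMove 𝕜 Y) (Q : ℕ → SecondMove Unit 𝕜 (Y × W))
    (ψ : ℕ → ℕ → Y × W) (j : ℕ) :
    windowSet p Q ψ (2 * j + 1) = ψ j '' (Q j).indices := by
  rw [windowSet, if_neg (by omega), show (2 * j + 1) / 2 = j by omega]

theorem windowStart_even (p : ℕ → FirstMove 𝕜 Y) (q : ℕ → SecondMove ℕ 𝕜 Y) (j : ℕ) :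
    windowStart p q (2 * j) = 2 * prevCut q j := by
  simp [windowStart]

theorem windowStart_odd (p : ℕ → FirstMove 𝕜 Y) (q : ℕ → SecondMove ℕ 𝕜 Y) (j : ℕ) :
    windowStart p q (2 * j + 1) = 2 * (p j).cut := by
  rw [windowStart, if_neg (by omega), show (2 * j + 1) / 2 = j by omega]

theorem span_inl_image {s : Set Y} {β : Y × W}
    (hβ : β ∈ Submodule.span 𝕜 ((fun b => (b, (0 : W))) '' s)) :
    ∃ b ∈ Submodule.span 𝕜 s, β = (b, 0) := by
  rw [show (fun b => (b, (0 : W))) = LinearMap.inl 𝕜 Y W from rfl, Submodule.span_image] at hβ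
  obtain ⟨b, hb, rfl⟩ := hβ
  exact ⟨b, hb, rfl⟩

theorem inl_mem_span_image {s : Set Y} {b : Y} (hb : b ∈ Submodule.span 𝕜 s) :
    (b, (0 : W)) ∈ Submodule.span 𝕜 ((fun b => (b, (0 : W))) '' s) := by
  rw [show (fun b => (b, (0 : W))) = LinearMap.inl 𝕜 Y W from rfl, Submodule.span_image]
  exact ⟨b, hb, rfl⟩

/-! ### The rules pass between the main game and the auxiliary games -/

namespace InterleavedPlay

variable {y : SchauderBasis 𝕜 Y} {e : SchauderBasis 𝕜 W} {J : W →L[𝕜] Y}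
  {lab : ℕ → ℕ} {x : ℕ → ℕ → Y} {κ η : ℕ → ℝ}
  {p : ℕ → FirstMove 𝕜 Y} {q : ℕ → SecondMove ℕ 𝕜 Y}
  {P : ℕ → FirstMove 𝕜 (Y × W)} {Q : ℕ → SecondMove Unit 𝕜 (Y × W)} {ψ : ℕ → ℕ → Y × W}

variable (y e J lab x P Q) in
/-- The second player obeys the rules on turn `k` in the auxiliary game with label `lab k`. -/
def AuxSecondLegal (τ : ℕ → ℕ → ℝ) (k : ℕ) : Prop :=
  SecondLegal (interleavedBasis y e J) (fun _ m => (x (lab k) m, (0 : W))) (τ (lab k))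
    (fun i => P (turn lab (lab k) i)) (fun i => Q (turn lab (lab k) i)) (turnCount lab (lab k) k)

variable (y e J lab P Q) in
/-- The first player obeys the rules on turn `k` in the auxiliary game with label `lab k`. -/
def AuxFirstLegal (k : ℕ) : Prop :=
  FirstLegal (interleavedBasis y e J) (fun i => P (turn lab (lab k) i))
    (fun i => Q (turn lab (lab k) i)) (turnCount lab (lab k) k)

/-- In the sup norm `(b, 0)` has the norm of `b`, so the rule of the auxiliary game can be read in
`Y`. -/
theorem picked_small_inl {τ : ℕ → ℕ → ℝ} {k : ℕ} (h : AuxSecondLegal y e J lab x P Q τ k) :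
    ∀ b ∈ Submodule.span 𝕜 (x (lab k) '' (Q k).indices), b ≠ 0 →
      ∀ t ∈ (P k).tests, ‖t.1 (b, 0)‖ < t.2 * ‖b‖ := by
  intro b hb hb0 t ht
  have h1 := h.picked_small (b, 0)
  simp only [turn_turnCount] at h1
  have h2 := h1 (by
    have := inl_mem_span_image (W := W) hb
    rwa [Set.image_image] at this) (by simpa using hb0) t ht
  simpa [Prod.norm_def] using h2

variable {τ : ℕ → ℕ → ℝ}

theorem aux_tests_pos_of_legal {k : ℕ} (h : AuxSecondLegal y e J lab x P Q τ k) :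
    ∀ t ∈ (Q k).tests, 0 < t.2 := by
  have := h.tests_pos
  simpa only [turn_turnCount] using this

theorem lift_of_legal (H : InterleavedPlay y e J lab x κ η p q P Q ψ)
    {k : ℕ} (h : AuxSecondLegal y e J lab x P Q τ k) :
    (∀ m ∈ (Q k).indices, (ψ k m).1 = x (lab k) m ∧
      ψ k m ∈ blockSpan (interleavedBasis y e J) (2 * (p k).cut) (2 * (q k).cut)) ∧
    ∀ β ∈ Submodule.span 𝕜 (ψ k '' (Q k).indices), ‖β.2‖ ≤ η k * ‖β.1‖ :=
  H.lift k (picked_small_inl h)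

theorem fst_mem_of_legal (H : InterleavedPlay y e J lab x κ η p q P Q ψ)
    {k : ℕ} (h : AuxSecondLegal y e J lab x P Q τ k) {β : Y × W}
    (hβ : β ∈ Submodule.span 𝕜 (ψ k '' (Q k).indices)) :
    β.1 ∈ Submodule.span 𝕜 (x (lab k) '' (Q k).indices) := by
  have h1 := Submodule.mem_map_of_mem (f := LinearMap.fst 𝕜 Y W) hβ
  rw [← Submodule.span_image, Set.image_image] at h1
  refine Submodule.span_mono ?_ h1
  rintro _ ⟨m, hm, rfl⟩
  exact ⟨m, hm, ((H.lift_of_legal h).1 m hm).1.symm⟩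

/-- The functionals chosen earlier in the auxiliary games are small on the lifts of the vectors
picked on turn `k`. -/
theorem lift_small (H : InterleavedPlay y e J lab x κ η p q P Q ψ)
    {k : ℕ} (h : AuxSecondLegal y e J lab x P Q τ k) {β : Y × W}
    (hβ : β ∈ Submodule.span 𝕜 (ψ k '' (Q k).indices)) {i : ℕ} (hi : i < k)
    {t : StrongDual 𝕜 (Y × W) × ℝ} (ht : t ∈ (Q i).tests) (ht0 : 0 < t.2) :
    ‖t.1 β‖ ≤ t.2 * (2 * κ k) * ‖β‖ := by
  have h1 : ‖t.1 (β.1, 0)‖ ≤ t.2 * κ k * ‖β.1‖ := by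
    by_cases h0 : β.1 = 0
    · rw [h0, ← Prod.zero_eq_mk]
      simp
    · exact (picked_small_inl h _ (H.fst_mem_of_legal h hβ) h0 _ (H.aux_tests_prev k i hi t ht)).le
  -- The tests only see first coordinates; here `η k`, chosen after the functional `t`, takes care
  -- of the second.
  have h2 : ‖t.1 (0, β.2)‖ ≤ t.2 * κ k * ‖β.1‖ := by
    calc ‖t.1 (0, β.2)‖ ≤ ‖t.1‖ * ‖((0 : Y), β.2)‖ := t.1.le_opNorm _
      _ = ‖t.1‖ * ‖β.2‖ := by simp [Prod.norm_def]
      _ ≤ ‖t.1‖ * (η k * ‖β.1‖) :=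
          mul_le_mul_of_nonneg_left ((H.lift_of_legal h).2 β hβ) (norm_nonneg _)
      _ = ‖t.1‖ * η k * ‖β.1‖ := (mul_assoc _ _ _).symm
      _ ≤ _ := mul_le_mul_of_nonneg_right (H.eta_tests k i hi t ht ht0) (norm_nonneg _)
  have h3 : 0 ≤ t.2 * κ k := (mul_nonneg (norm_nonneg t.1) (H.eta_nonneg k)).trans
    (H.eta_tests k i hi t ht ht0)
  have h4 : t.1 β = t.1 (β.1, 0) + t.1 (0, β.2) := by
    rw [← map_add]
    simp
  calc ‖t.1 β‖ ≤ t.2 * κ k * ‖β.1‖ + t.2 * κ k * ‖β.1‖ := by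
        rw [h4]
        exact norm_add_le_of_le h1 h2
    _ = t.2 * (2 * κ k) * ‖β.1‖ := by ring
    _ ≤ _ := mul_le_mul_of_nonneg_left (norm_fst_le β) (by linarith)

/-- The functionals chosen earlier in the auxiliary games are small on the vectors which the first
player chooses on turn `k`. -/
theorem blocks_small (H : InterleavedPlay y e J lab x κ η p q P Q ψ)
    {k : ℕ} (h : FirstLegal y p q k) {b : Y}
    (hb : b ∈ Submodule.span 𝕜 ((p k).blocks : Set Y)) {i : ℕ} (hi : i < k)
    {t : StrongDual 𝕜 (Y × W) × ℝ} (ht : t ∈ (Q i).tests) :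
    ‖t.1 (b, 0)‖ ≤ t.2 * κ k * ‖b‖ := by
  by_cases h0 : b = 0
  · rw [h0, ← Prod.zero_eq_mk]
    simp
  · obtain ⟨j, rfl⟩ : ∃ j, k = j + 1 := ⟨k - 1, by omega⟩
    exact (h.blocks_small b hb h0 _ ((H.mem_tests j _).2 ⟨i, by omega, t, ht, rfl⟩)).le

theorem windowStart_le (H : InterleavedPlay y e J lab x κ η p q P Q ψ)
    {s : ℕ} (h : ∀ j, 2 * j ≤ s → FirstLegal y p q j) :
    windowStart p q s ≤ windowStart p q (s + 1) := by
  rcases Nat.even_or_odd' s with ⟨j, rfl | rfl⟩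
  · rw [windowStart_even, windowStart_odd]
    exact Nat.mul_le_mul_left _ (h j le_rfl).cut_le
  · rw [windowStart_odd, show 2 * j + 1 + 1 = 2 * (j + 1) by ring, windowStart_even]
    exact Nat.mul_le_mul_left _ (H.cut_lt j).le

theorem windowSet_subset (H : InterleavedPlay y e J lab x κ η p q P Q ψ)
    {s : ℕ} (h : ∀ j, 2 * j ≤ s → FirstLegal y p q j)
    (h' : ∀ j, 2 * j < s → AuxSecondLegal y e J lab x P Q τ j) :
    windowSet p Q ψ s ⊆
      blockSpan (interleavedBasis y e J) (windowStart p q s) (windowStart p q (s + 1)) := by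
  rcases Nat.even_or_odd' s with ⟨j, rfl | rfl⟩
  · rw [windowStart_even, windowStart_odd, windowSet_even]
    rintro _ ⟨b, hb, rfl⟩
    exact inl_mem_blockSpan y e J ((h j le_rfl).blocks_mem b hb)
  · rw [windowStart_odd, show 2 * j + 1 + 1 = 2 * (j + 1) by ring, windowStart_even, windowSet_odd]
    rintro _ ⟨m, hm, rfl⟩
    exact ((H.lift_of_legal (h' j (by omega))).1 m hm).2

/-- The functionals chosen earlier in the auxiliary games are small on each window. -/
theorem window_small (H : InterleavedPlay y e J lab x κ η p q P Q ψ)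
    {A : ℝ} (hA : 0 < A) (hκ : ∀ j, κ j = (1 / 2) ^ (2 * j + 4) / A) {s : ℕ}
    (h : ∀ j, 2 * j ≤ s → FirstLegal y p q j)
    (h' : ∀ j, 2 * j < s → AuxSecondLegal y e J lab x P Q τ j) {β : Y × W}
    (hβ : β ∈ Submodule.span 𝕜 (windowSet p Q ψ s)) {i : ℕ} (hi : i < s / 2)
    {t : StrongDual 𝕜 (Y × W) × ℝ} (ht : t ∈ (Q i).tests) (ht0 : 0 < t.2) :
    ‖t.1 β‖ ≤ t.2 * ((1 / 2) ^ (s + 2) / A) * ‖β‖ := by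
  rcases Nat.even_or_odd' s with ⟨j, rfl | rfl⟩
  · rw [windowSet_even] at hβ
    obtain ⟨b, hb, rfl⟩ := span_inl_image hβ
    refine (H.blocks_small (h j le_rfl) hb (by omega) ht).trans ?_
    rw [show ‖(b, (0 : W))‖ = ‖b‖ by simp [Prod.norm_def], hκ]
    gcongr ?_ * (?_ / _) * _
    exact pow_le_pow_of_le_one (by norm_num) (by norm_num) (by omega)
  · rw [windowSet_odd] at hβ
    refine (H.lift_small (h' j (by omega)) hβ (by omega) ht ht0).trans ?_
    rw [hκ, show 2 * ((1 / 2 : ℝ) ^ (2 * j + 4) / A) = (1 / 2) ^ (2 * j + 1 + 2) / A by ring]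

theorem prevCut_le_of_lt (H : InterleavedPlay y e J lab x κ η p q P Q ψ)
    {j k : ℕ} (hjk : j < k) (h : ∀ i ≤ k, FirstLegal y p q i) :
    (q j).cut ≤ prevCut q k := by
  induction k with
  | zero => omega
  | succ k ih =>
    rcases Nat.lt_succ_iff_lt_or_eq.1 hjk with hlt | rfl
    · exact (ih hlt fun i hi => h i (by omega)).trans
        ((h k (by omega)).cut_le.trans (H.cut_lt k).le)
    · exact le_rfl

theorem cut_mono (H : InterleavedPlay y e J lab x κ η p q P Q ψ) {j k : ℕ} (hjk : j ≤ k)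
    (h : ∀ i ≤ k, FirstLegal y p q i) : (p j).cut ≤ (p k).cut := by
  rcases hjk.lt_or_eq with hlt | rfl
  · exact ((H.cut_lt j).le.trans (H.prevCut_le_of_lt hlt h)).trans (h k le_rfl).cut_le
  · exact le_rfl

/-- The moves of an auxiliary game end before the next vectors which enter it. -/
theorem prevCut_aux_le (H : InterleavedPlay y e J lab x κ η p q P Q ψ) {j k : ℕ} (hjk : j ≤ k)
    (hj : Fresh lab j k) (h : ∀ i ≤ k, FirstLegal y p q i) :
    prevCut (fun i => Q (turn lab (lab k) i)) (turnCount lab (lab k) k) ≤ 2 * prevCut q j := by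
  rcases hc : turnCount lab (lab k) k with _ | s
  · exact Nat.zero_le _
  · have hs : s < turnCount lab (lab k) k := by omega
    have hlt : turn lab (lab k) s < j := by
      by_contra hle
      exact hj _ (not_lt.1 hle) (turn_lt hs) (lab_turn hs)
    exact (H.cut_le _).trans (Nat.mul_le_mul_left _
      (H.prevCut_le_of_lt hlt fun i hi => h i (hi.trans hjk)))

/-- The first player obeys the rules of the auxiliary games, if he does so in the main game. -/
theorem auxFirstLegal (H : InterleavedPlay y e J lab x κ η p q P Q ψ) {A : ℝ} (hA : 0 < A)
    (hW : WindowBound (interleavedBasis y e J) A)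
    (hκ : ∀ j, κ j = (1 / 2) ^ (2 * j + 4) / A) {k : ℕ}
    (h : ∀ j ≤ k, FirstLegal y p q j)
    (h' : ∀ j < k, AuxSecondLegal y e J lab x P Q τ j) : AuxFirstLegal y e J lab P Q k where
  cut_le := by
    rw [turn_turnCount, H.aux_cut]
    exact (H.prevCut_aux_le le_rfl (fun i hi hi' => by omega) h).trans
      (Nat.mul_le_mul_left _ (h k le_rfl).cut_le)
  tests_pos := by
    rw [turn_turnCount]
    exact H.aux_tests_pos k (h k le_rfl).tests_pos fun j hj => aux_tests_pos_of_legal (h' j hj)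
  blocks_mem b hb := by
    rw [turn_turnCount, H.mem_aux_blocks] at hb
    rw [turn_turnCount, H.aux_cut]
    obtain ⟨j, hjk, hj, ⟨b, hb, rfl⟩ | ⟨hlt, m, hm, rfl⟩⟩ := hb
    · exact blockSpan_mono _ (H.prevCut_aux_le hjk hj h) (Nat.mul_le_mul_left _ (H.cut_mono hjk h))
        (inl_mem_blockSpan y e J ((h j hjk).blocks_mem b hb))
    · refine blockSpan_mono _ ((H.prevCut_aux_le hjk hj h).trans
        (Nat.mul_le_mul_left _ (h j hjk).cut_le)) (Nat.mul_le_mul_left _ ?_)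
        ((H.lift_of_legal (h' j hlt)).1 m hm).2
      exact (H.prevCut_le_of_lt hlt h).trans (h k le_rfl).cut_le
  blocks_small β hβ hβ0 t ht := by
    rw [turn_turnCount] at hβ
    rcases hc : turnCount lab (lab k) k with _ | i
    · rw [hc] at ht
      simp [prevTests] at ht
    rw [hc] at ht
    change t ∈ (Q (turn lab (lab k) i)).tests at ht
    have hi : i < turnCount lab (lab k) k := by omega
    set k' := turn lab (lab k) i with hk'
    have hk'k : k' < k := turn_lt hi
    have ht0 : 0 < t.2 := aux_tests_pos_of_legal (h' k' hk'k) t ht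
    have hleg : ∀ s < 2 * k + 1, ∀ j, 2 * j ≤ s → FirstLegal y p q j :=
      fun s hs j hj => h j (by omega)
    have hleg' : ∀ s < 2 * k + 1, ∀ j, 2 * j < s → AuxSecondLegal y e J lab x P Q τ j :=
      fun s hs j hj => h' j (by omega)
    -- Only windows after turn `k'` contribute, so `t` was already known when their vectors were
    -- chosen. There are `2 * k + 1` windows because nothing has been picked on turn `k` yet.
    obtain ⟨γ, hsum, hγ, hγn⟩ := hW.exists_parts (2 * k + 1) (windowStart p q)
      (fun s => {b | k' < s / 2 ∧ b ∈ windowSet p Q ψ s})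
      (fun s hs => H.windowStart_le (hleg s hs))
      (fun s hs b hb => H.windowSet_subset (hleg s hs) (hleg' s hs) hb.2) (β := β) (by
        refine Submodule.span_mono ?_ hβ
        intro b hb
        obtain ⟨j, hjk, hj, hb⟩ := (H.mem_aux_blocks k b).1 hb
        have hlt : k' < j := by
          by_contra hle
          exact hj _ (not_lt.1 hle) hk'k (lab_turn hi)
        simp only [Set.mem_iUnion]
        rcases hb with ⟨b', hb', rfl⟩ | ⟨hlt', m, hm, rfl⟩
        · refine ⟨2 * j, by omega, by omega, ?_⟩
          rw [windowSet_even]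
          exact ⟨b', hb', rfl⟩
        · refine ⟨2 * j + 1, by omega, by omega, ?_⟩
          rw [windowSet_odd]
          exact ⟨m, hm, rfl⟩)
    have hpart : ∀ s ∈ Finset.range (2 * k + 1),
        ‖t.1 (γ s)‖ ≤ t.2 * ‖β‖ / 4 * (1 / 2) ^ s := fun s hs => by
      rw [Finset.mem_range] at hs
      have h1 := hγ s hs
      by_cases hks : k' < s / 2
      · have h2 := H.window_small hA hκ (hleg s hs) (hleg' s hs)
          (Submodule.span_mono (fun b hb => hb.2) h1) hks ht ht0
        refine h2.trans ((mul_le_mul_of_nonneg_left (hγn s) (by positivity)).trans_eq ?_)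
        field_simp
        ring
      · have h2 : γ s = 0 := by simpa [hks] using h1
        rw [h2, map_zero, norm_zero]
        positivity
    have hβpos : 0 < ‖β‖ := norm_pos_iff.2 hβ0
    calc ‖t.1 β‖ = ‖∑ s ∈ Finset.range (2 * k + 1), t.1 (γ s)‖ := by rw [← map_sum, ← hsum]
      _ ≤ ∑ s ∈ Finset.range (2 * k + 1), t.2 * ‖β‖ / 4 * (1 / 2) ^ s := norm_sum_le_of_le _ hpart
      _ = t.2 * ‖β‖ / 4 * ∑ s ∈ Finset.range (2 * k + 1), (1 / 2 : ℝ) ^ s :=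
          (Finset.mul_sum _ _ _).symm
      -- The geometric series leaves half of the tolerance unused, whence the strict inequality.
      _ ≤ t.2 * ‖β‖ / 4 * 2 :=
          mul_le_mul_of_nonneg_left (sum_geometric_two_le _) (by positivity)
      _ < t.2 * ‖β‖ := by nlinarith [mul_pos ht0 hβpos]

/-- All rules of the auxiliary games are obeyed, if the first player obeys those of the main
game. -/
theorem auxLegal (H : InterleavedPlay y e J lab x κ η p q P Q ψ) {A : ℝ} (hA : 0 < A)
    (hW : WindowBound (interleavedBasis y e J) A)
    (hκ : ∀ j, κ j = (1 / 2) ^ (2 * j + 4) / A)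
    (hwin : ∀ n i, (∀ j ≤ i, FirstLegal (interleavedBasis y e J) (fun i => P (turn lab n i))
        (fun i => Q (turn lab n i)) j) →
      SecondLegal (interleavedBasis y e J) (fun _ m => (x n m, (0 : W))) (τ n)
        (fun i => P (turn lab n i)) (fun i => Q (turn lab n i)) i) {k : ℕ}
    (h : ∀ j ≤ k, FirstLegal y p q j) :
    AuxFirstLegal y e J lab P Q k ∧ AuxSecondLegal y e J lab x P Q τ k := by
  induction k using Nat.strong_induction_on with
  | _ k ih =>
    have h1 : ∀ j < k, AuxFirstLegal y e J lab P Q j ∧ AuxSecondLegal y e J lab x P Q τ j :=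
      fun j hj => ih j hj fun i hi => h i (by omega)
    have h2 := H.auxFirstLegal hA hW hκ h fun j hj => (h1 j hj).2
    -- The auxiliary strategy needs legality on all turns with this label: earlier ones come from
    -- induction, the present one is `h2`.
    refine ⟨h2, hwin _ _ fun j hj => ?_⟩
    rcases hj.lt_or_eq with hlt | rfl
    · have h3 := (h1 _ (turn_lt hlt)).1
      rwa [AuxFirstLegal, lab_turn hlt, turnCount_turn hlt] at h3
    · exact h2

/-- The second player obeys the rules of the main game, if he does so in the auxiliary games. -/
theorem secondLegal (H : InterleavedPlay y e J lab x κ η p q P Q ψ) {A : ℝ} (hA : 0 < A)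
    (hκ : ∀ j, κ j = (1 / 2) ^ (2 * j + 4) / A) {σ : ℕ → ℝ}
    (hσ : ∀ k, (1 + ‖J‖) * τ (lab k) (turnCount lab (lab k) k) ≤ σ k) {k : ℕ}
    (h : ∀ j ≤ k, AuxSecondLegal y e J lab x P Q τ j) : SecondLegal y x σ p q k := by
  have hk := h k le_rfl
  have hap := hk.approx_mem
  have hsu := hk.approx_successive
  have hcl := hk.approx_close
  simp only [turn_turnCount] at hap hsu hcl
  refine ⟨H.cut_lt k, ?_, ?_, ?_, ?_, ?_, ?_, ?_⟩
  · have := hk.indices_nonempty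
    rwa [turn_turnCount, ← H.indices] at this
  · intro j hj hl a ha m hm
    rw [H.label, H.label] at hl
    rw [H.indices] at ha hm
    have h1 := hk.indices_gt (turnCount lab (lab k) j) (turnCount_lt hj hl) rfl
    rw [turn_turnCount] at h1
    refine h1 a ?_ m hm
    rw [← hl, turn_turnCount]
    exact ha
  · intro m hm
    rw [H.indices] at hm
    rw [H.approx]
    refine unshear_mem_blockSpan y e J ?_ (H.cut_le k)
    rw [← H.aux_cut]
    exact hap m hm
  · intro m hm m' hm' hmm i hi j hj
    rw [H.indices] at hm hm'
    -- Coordinate `i` of the sheared block is coordinate `2 * i` of the auxiliary block.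
    have := hsu m hm m' hm' hmm (2 * i) (by
      simpa [basisSupport, interleavedBasis_coord_even, H.approx] using hi) (2 * j) (by
      simpa [basisSupport, interleavedBasis_coord_even, H.approx] using hj)
    omega
  · rw [H.indices, H.label]
    -- The shear fixes `(x, 0)` in its first coordinate and has norm at most `1 + ‖J‖`.
    refine lt_of_le_of_lt ?_ ((mul_lt_mul_of_pos_left hcl
      (by positivity : 0 < 1 + ‖J‖)).trans_le (hσ k))
    rw [Finset.mul_sum]
    refine Finset.sum_le_sum fun m _ => ?_
    rw [H.approx]
    set v := ((x (lab k) m, (0 : W)) : Y × W) - (Q k).approx m with hv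
    have h1 : x (lab k) m - (((Q k).approx m).1 - J ((Q k).approx m).2) = v.1 - J v.2 := by
      simp [hv]
      abel
    rw [h1]
    calc ‖v.1 - J v.2‖ ≤ ‖v.1‖ + ‖J‖ * ‖v.2‖ :=
          (norm_sub_le _ _).trans (add_le_add_right (J.le_opNorm _) _)
      _ ≤ ‖v‖ + ‖J‖ * ‖v‖ := add_le_add (norm_fst_le v)
          (mul_le_mul_of_nonneg_left (norm_snd_le v) (norm_nonneg _))
      _ = (1 + ‖J‖) * ‖v‖ := by ring
  · intro b hb hb0 t ht
    rw [H.label, H.indices] at hb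
    exact picked_small_inl hk b hb hb0 _ (H.aux_tests_first k t ht)
  · intro t ht
    obtain ⟨j, hj, t', ht', rfl⟩ := (H.mem_tests k t).1 ht
    refine mul_pos (aux_tests_pos_of_legal (h j hj) t' ht') ?_
    rw [hκ]
    positivity

end InterleavedPlay

end Play

/-! ### Projections pass to the first coordinate -/

section Transfer

variable {𝕜 : Type*} [RCLike 𝕜]
variable {Y : Type*} [NormedAddCommGroup Y] [NormedSpace 𝕜 Y]
variable {W : Type*} [NormedAddCommGroup W] [NormedSpace 𝕜 W]

theorem subset_closedSpan (S : Set Y) : S ⊆ closedSpan 𝕜 S :=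
  Submodule.subset_span.trans (Submodule.le_topologicalClosure _)

theorem closedSpan_mono {S S' : Set Y} (h : S ⊆ S') : closedSpan 𝕜 S ≤ closedSpan 𝕜 S' :=
  Submodule.topologicalClosure_mono (Submodule.span_mono h)

theorem norm_snd_le_norm_fst_of_mem_closedSpan {S : Set (Y × W)}
    (h : ∀ v ∈ Submodule.span 𝕜 S, ‖v.2‖ ≤ ‖v.1‖) : ∀ v ∈ closedSpan 𝕜 S, ‖v.2‖ ≤ ‖v.1‖ := by
  intro v hv
  have hcl : IsClosed {v : Y × W | ‖v.2‖ ≤ ‖v.1‖} :=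
    isClosed_le continuous_snd.norm continuous_fst.norm
  exact closure_minimal h hcl hv

/-- The first coordinate is isometric on the closed span, which is complete; its image is therefore
closed and no further closure is needed. -/
theorem closedSpan_fst_image [CompleteSpace Y] [CompleteSpace W] {S : Set (Y × W)}
    (h : ∀ v ∈ closedSpan 𝕜 S, ‖v.2‖ ≤ ‖v.1‖) (w : Y) :
    w ∈ closedSpan 𝕜 (Prod.fst '' S) ↔ ∃ v ∈ closedSpan 𝕜 S, v.1 = w := by
  constructor
  · intro hw
    have hc : CompleteSpace (closedSpan 𝕜 S) :=
      (Submodule.isClosed_topologicalClosure _).completeSpace_coe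
    let g : closedSpan 𝕜 S →ₗᵢ[𝕜] Y :=
      { toLinearMap := (LinearMap.fst 𝕜 Y W).comp (closedSpan 𝕜 S).subtype
        norm_map' := fun v => (max_eq_left (h v v.2)).symm }
    have hcl : IsClosed (LinearMap.range g.toLinearMap : Set Y) := by
      rw [LinearMap.coe_range]
      exact g.isometry.isClosedEmbedding.isClosed_range
    have hle : closedSpan 𝕜 (Prod.fst '' S) ≤ LinearMap.range g.toLinearMap := by
      refine Submodule.topologicalClosure_minimal _ (Submodule.span_le.2 ?_) hcl
      rintro _ ⟨v, hv, rfl⟩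
      exact ⟨⟨v, subset_closedSpan S hv⟩, rfl⟩
    obtain ⟨v, rfl⟩ := hle hw
    exact ⟨v, v.2, rfl⟩
  · rintro ⟨v, hv, rfl⟩
    have hle : closedSpan 𝕜 S ≤
        (closedSpan 𝕜 (Prod.fst '' S)).comap (ContinuousLinearMap.fst 𝕜 Y W).toLinearMap := by
      refine Submodule.topologicalClosure_minimal _ (Submodule.span_le.2 ?_)
        ((Submodule.isClosed_topologicalClosure _).preimage continuous_fst)
      intro v hv
      exact subset_closedSpan _ ⟨v, hv, rfl⟩
    exact hle hv

/-- Small projections pass from `Y × W` to `Y`, where the first coordinate preserves the norm. -/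
theorem HasSmallProjection.fst_image [CompleteSpace Y] [CompleteSpace W] {V A : Set (Y × W)}
    {B ε : ℝ} (hP : HasSmallProjection 𝕜 V A B ε)
    (h : ∀ v ∈ Submodule.span 𝕜 (A ∪ V), ‖v.2‖ ≤ ‖v.1‖) :
    HasSmallProjection 𝕜 (Prod.fst '' V) (Prod.fst '' A) B ε := by
  obtain ⟨P, hP1, hP2, hP3, hP4⟩ := hP
  have h' := norm_snd_le_norm_fst_of_mem_closedSpan h
  have hV : ∀ v ∈ closedSpan 𝕜 V, ‖v.2‖ ≤ ‖v.1‖ :=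
    fun v hv => h' v (closedSpan_mono Set.subset_union_right hv)
  have hA : ∀ v ∈ closedSpan 𝕜 A, ‖v.2‖ ≤ ‖v.1‖ :=
    fun v hv => h' v (closedSpan_mono Set.subset_union_left hv)
  let g : closedSpan 𝕜 (A ∪ V) →ₗᵢ[𝕜] Y :=
    { toLinearMap := (LinearMap.fst 𝕜 Y W).comp (closedSpan 𝕜 (A ∪ V)).subtype
      norm_map' := fun v => (max_eq_left (h' v v.2)).symm }
  have hg : ∀ w : closedSpan 𝕜 (Prod.fst '' A ∪ Prod.fst '' V),
      (w : Y) ∈ LinearMap.range g.toLinearMap := by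
    rintro ⟨w, hw⟩
    rw [← Set.image_union, closedSpan_fst_image h'] at hw
    obtain ⟨v, hv, rfl⟩ := hw
    exact ⟨⟨v, hv⟩, rfl⟩
  -- The inverse of the isometry; the projection wanted is `P` conjugated by it.
  let R : closedSpan 𝕜 (Prod.fst '' A ∪ Prod.fst '' V) →L[𝕜] closedSpan 𝕜 (A ∪ V) :=
    (g.equivRange.symm.toContinuousLinearEquiv : _ →L[𝕜] _).comp
      ((closedSpan 𝕜 (Prod.fst '' A ∪ Prod.fst '' V)).subtypeL.codRestrict _ hg)
  have hR : ∀ w, g (R w) = w := fun w =>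
    congrArg Subtype.val (g.equivRange.apply_symm_apply ⟨(w : Y), hg w⟩)
  have hRn : ∀ w, ‖R w‖ = ‖w‖ := fun w => by
    rw [← g.norm_map, hR]
    rfl
  have hRu : ∀ (w : closedSpan 𝕜 (Prod.fst '' A ∪ Prod.fst '' V)) (v : Y × W),
      v ∈ closedSpan 𝕜 (A ∪ V) → v.1 = (w : Y) → (R w : Y × W) = v := by
    intro w v hv hvw
    have : R w = ⟨v, hv⟩ := g.injective ((hR w).trans hvw.symm)
    rw [this]
  have hPn : ∀ w, ‖(P (R w)).1‖ ≤ ‖P (R w)‖ := fun w => norm_fst_le _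
  refine ⟨(ContinuousLinearMap.fst 𝕜 Y W).comp (P.comp R), fun w => ?_, fun w hw => ?_, ?_,
    fun w hw => ?_⟩
  · exact (closedSpan_fst_image hV _).2 ⟨_, hP1 (R w), rfl⟩
  · obtain ⟨v, hv, hvw⟩ := (closedSpan_fst_image hV _).1 hw
    have h1 := hRu w v (closedSpan_mono Set.subset_union_right hv) hvw
    change (P (R w)).1 = w
    rw [hP2 (R w) (h1 ▸ hv), h1, hvw]
  · refine ContinuousLinearMap.opNorm_le_bound _ ((norm_nonneg P).trans hP3) fun w => ?_
    exact (hPn w).trans ((P.le_of_opNorm_le hP3 _).trans_eq (by rw [hRn]))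
  · obtain ⟨v, hv, hvw⟩ := (closedSpan_fst_image hA _).1 hw
    have h1 := hRu w v (closedSpan_mono Set.subset_union_left hv) hvw
    refine (hPn w).trans ((hP4 (R w) (h1 ▸ hv)).trans_eq (by rw [hRn]))

end Transfer

/-! ### The outcome of the interleaved play -/

namespace InterleavedPlay

variable {𝕜 : Type*} [RCLike 𝕜]
variable {Y : Type*} [NormedAddCommGroup Y] [NormedSpace 𝕜 Y]
variable {W : Type*} [NormedAddCommGroup W] [NormedSpace 𝕜 W]
variable {y : SchauderBasis 𝕜 Y} {e : SchauderBasis 𝕜 W} {J : W →L[𝕜] Y}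
  {lab : ℕ → ℕ} {x : ℕ → ℕ → Y} {κ η : ℕ → ℝ}
  {p : ℕ → FirstMove 𝕜 Y} {q : ℕ → SecondMove ℕ 𝕜 Y}
  {P : ℕ → FirstMove 𝕜 (Y × W)} {Q : ℕ → SecondMove Unit 𝕜 (Y × W)} {ψ : ℕ → ℕ → Y × W}

variable {τ : ℕ → ℕ → ℝ}

theorem exists_fresh {n j : ℕ} (hlab : ∃ k, j ≤ k ∧ lab k = n) :
    ∃ k, j ≤ k ∧ lab k = n ∧ Fresh lab j k := by
  classical
  refine ⟨Nat.find hlab, (Nat.find_spec hlab).1, (Nat.find_spec hlab).2, fun i hji hi h => ?_⟩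
  exact Nat.find_min hlab hi ⟨hji, h.trans (Nat.find_spec hlab).2⟩

/-- The vectors which the first player chooses in the auxiliary game with label `n`. -/
theorem firstBlocks_aux (H : InterleavedPlay y e J lab x κ η p q P Q ψ)
    (hlab : ∀ n, {k | lab k = n}.Infinite) (n : ℕ) :
    firstBlocks (fun i => P (turn lab n i)) = {b | ∃ j, (∃ b' ∈ (p j).blocks, b = (b', 0)) ∨
      (lab j ≠ n ∧ ∃ m ∈ (Q j).indices, b = ψ j m)} := by
  ext b
  constructor
  · rintro ⟨i, hi⟩
    have hn : lab (turn lab n i) = n := Nat.nth_mem_of_infinite (hlab n) i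
    obtain ⟨j, -, hj, hb | ⟨hlt, hb⟩⟩ := (H.mem_aux_blocks _ _).1 hi
    · exact ⟨j, Or.inl hb⟩
    · exact ⟨j, Or.inr ⟨fun h => hj j le_rfl hlt (h.trans hn.symm), hb⟩⟩
  · rintro ⟨j, hb⟩
    obtain ⟨k', hk'1, hk'2⟩ := (hlab n).exists_gt j
    -- A vector of turn `j` enters game `n` at the first turn with label `n` from `j` on.
    obtain ⟨k, hjk, rfl, hk⟩ := exists_fresh ⟨k', hk'2.le, hk'1⟩
    refine ⟨turnCount lab (lab k) k, ?_⟩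
    beta_reduce
    rw [turn_turnCount, H.mem_aux_blocks]
    refine ⟨j, hjk, hk, hb.imp id fun hb => ⟨?_, hb.2⟩⟩
    exact hjk.lt_of_ne fun h => hb.1 (by rw [h])

theorem picked_aux (H : InterleavedPlay y e J lab x κ η p q P Q ψ)
    (hlab : ∀ n, {k | lab k = n}.Infinite) (n : ℕ) :
    picked (fun i => Q (turn lab n i)) () = picked q n := by
  ext m
  constructor
  · rintro ⟨i, -, hi⟩
    exact ⟨turn lab n i, (H.label _).trans (Nat.nth_mem_of_infinite (hlab n) i),
      by rwa [H.indices]⟩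
  · rintro ⟨k, hk, hm⟩
    rw [H.label] at hk
    subst hk
    refine ⟨turnCount lab (lab k) k, rfl, ?_⟩
    beta_reduce
    rwa [turn_turnCount, ← H.indices]

theorem snd_window_le (H : InterleavedPlay y e J lab x κ η p q P Q ψ) {A : ℝ}
    (hA : 0 < A) (hκ : ∀ j, κ j = (1 / 2) ^ (2 * j + 4) / A)
    (h' : ∀ j, AuxSecondLegal y e J lab x P Q τ j) {s : ℕ} {β : Y × W}
    (hβ : β ∈ Submodule.span 𝕜 (windowSet p Q ψ s)) :
    ‖β.2‖ ≤ (1 / 2) ^ s / 4 / A * ‖β‖ := by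
  rcases Nat.even_or_odd' s with ⟨j, rfl | rfl⟩
  · rw [windowSet_even] at hβ
    obtain ⟨b, hb, rfl⟩ := span_inl_image hβ
    rw [norm_zero]
    positivity
  · rw [windowSet_odd] at hβ
    refine ((H.lift_of_legal (h' j)).2 β hβ).trans
      (mul_le_mul ((H.eta_le j).trans ?_) (norm_fst_le β) (norm_nonneg _) (by positivity))
    rw [hκ]
    gcongr
    rw [show (1 / 2 : ℝ) ^ (2 * j + 1) / 4 = (1 / 2) ^ (2 * j + 3) by ring]
    exact pow_le_pow_of_le_one (by norm_num) (by norm_num) (by omega)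

/-- On the span of the vectors of an auxiliary game the norm is that of the first coordinate. -/
theorem norm_snd_le_norm_fst (H : InterleavedPlay y e J lab x κ η p q P Q ψ) {A : ℝ}
    (hA : 0 < A) (hW : WindowBound (interleavedBasis y e J) A)
    (hκ : ∀ j, κ j = (1 / 2) ^ (2 * j + 4) / A)
    (hlab : ∀ n, {k | lab k = n}.Infinite)
    (h : ∀ j, FirstLegal y p q j) (h' : ∀ j, AuxSecondLegal y e J lab x P Q τ j) (n : ℕ) :
    ∀ γ ∈ Submodule.span 𝕜 (firstBlocks (fun i => P (turn lab n i)) ∪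
      (fun m => (x n m, (0 : W))) '' picked q n), ‖γ.2‖ ≤ ‖γ.1‖ := by
  classical
  obtain ⟨R, hR1, hR2, hR⟩ := hW (windowStart p q) (windowSet p Q ψ)
    (monotone_nat_of_le_succ fun s => H.windowStart_le fun j _ => h j)
    (fun s => H.windowSet_subset (fun j _ => h j) fun j _ => h' j)
  -- The vectors of game `n` itself occur as `(x n m, 0)`, not as lifts. The weight `ζ` deletes the
  -- second coordinates of their windows, so that all windows can be handled with lifts.
  let ζ : ℕ → 𝕜 := fun s => if s % 2 = 1 ∧ lab (s / 2) = n then 0 else 1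
  have hζ : ∀ s, ‖ζ s‖ ≤ 1 := fun s => by
    by_cases hs : s % 2 = 1 ∧ lab (s / 2) = n <;> simp [ζ, hs]
  have hgen : ∀ γ ∈ firstBlocks (fun i => P (turn lab n i)) ∪
      (fun m => (x n m, (0 : W))) '' picked q n,
      ∃ s, ∃ β ∈ windowSet p Q ψ s, γ.1 = β.1 ∧ γ.2 = ζ s • β.2 := by
    intro γ hγ
    rw [H.firstBlocks_aux hlab] at hγ
    rcases hγ with ⟨j, ⟨b, hb, rfl⟩ | ⟨hj, m, hm, rfl⟩⟩ | ⟨m, ⟨k, hk, hm⟩, rfl⟩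
    · refine ⟨2 * j, (b, 0), ?_, rfl, by simp⟩
      rw [windowSet_even]
      exact ⟨b, hb, rfl⟩
    · refine ⟨2 * j + 1, ψ j m, ?_, rfl, ?_⟩
      · rw [windowSet_odd]
        exact ⟨m, hm, rfl⟩
      · simp only [ζ]
        rw [if_neg, one_smul]
        rw [show (2 * j + 1) / 2 = j by omega]
        exact fun h => hj h.2
    · rw [H.label] at hk
      rw [H.indices] at hm
      refine ⟨2 * k + 1, ψ k m, ?_, ?_, ?_⟩
      · rw [windowSet_odd]
        exact ⟨m, hm, rfl⟩
      · rw [((H.lift_of_legal (h' k)).1 m hm).1, hk]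
      · simp only [ζ]
        rw [if_pos, zero_smul]
        rw [show (2 * k + 1) / 2 = k by omega]
        exact ⟨by omega, hk⟩
  intro γ hγ
  -- Carrying `β` existentially through the induction avoids defining a linear map `γ ↦ β`.
  have key : ∃ β ∈ Submodule.span 𝕜 (⋃ s, windowSet p Q ψ s), γ.1 = β.1 ∧
      ∃ N, ∀ l, N ≤ l → γ.2 = ∑ s ∈ Finset.range l, ζ s • (R s β).2 := by
    induction hγ using Submodule.span_induction with
    | mem γ hγ =>
      obtain ⟨s, β, hβ, h1, h2⟩ := hgen γ hγ
      refine ⟨β, Submodule.subset_span (Set.mem_iUnion.2 ⟨s, hβ⟩), h1, s + 1, fun l hl => ?_⟩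
      rw [Finset.sum_eq_single_of_mem s (Finset.mem_range.2 hl) fun s' _ hs' => by
        rw [hR2 s s' hs'.symm β hβ]; simp, hR1 s β hβ, h2]
    | zero => exact ⟨0, zero_mem _, rfl, 0, fun l _ => by simp⟩
    | add γ γ' _ _ hγ hγ' =>
      obtain ⟨β, hβ, h1, N, hN⟩ := hγ
      obtain ⟨β', hβ', h1', N', hN'⟩ := hγ'
      refine ⟨β + β', add_mem hβ hβ', by simp [h1, h1'], max N N', fun l hl => ?_⟩
      simp only [map_add, Prod.snd_add, smul_add, Finset.sum_add_distrib]
      rw [← hN l (le_of_max_le_left hl), ← hN' l (le_of_max_le_right hl)]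
    | smul r γ _ hγ =>
      obtain ⟨β, hβ, h1, N, hN⟩ := hγ
      refine ⟨r • β, Submodule.smul_mem _ _ hβ, by simp [h1], N, fun l hl => ?_⟩
      simp only [map_smul, Prod.smul_snd, smul_comm _ r, ← Finset.smul_sum]
      rw [← hN l hl]
  obtain ⟨β, hβ, hγβ, N, hN⟩ := key
  obtain ⟨h1, h2, N', hN'⟩ := hR β hβ
  have hpart : ∀ s, ‖(R s β).2‖ ≤ ‖β‖ / 4 * (1 / 2) ^ s := fun s => by
    refine (H.snd_window_le hA hκ h' (h1 s)).trans
      ((mul_le_mul_of_nonneg_left (h2 s) (by positivity)).trans_eq ?_)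
    field_simp
  have hsum : ∀ l, ∑ s ∈ Finset.range l, ‖β‖ / 4 * (1 / 2 : ℝ) ^ s ≤ ‖β‖ / 2 := fun l => by
    rw [← Finset.mul_sum]
    exact (mul_le_mul_of_nonneg_left (sum_geometric_two_le l) (by positivity)).trans_eq (by ring)
  have hγ2 : ‖γ.2‖ ≤ ‖β‖ / 2 := by
    rw [hN N le_rfl]
    refine (norm_sum_le_of_le _ fun s _ => ?_).trans (hsum N)
    rw [norm_smul]
    exact (mul_le_of_le_one_left (norm_nonneg _) (hζ s)).trans (hpart s)
  have hβ2 : ‖β.2‖ ≤ ‖β‖ / 2 := by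
    have h3 : β.2 = ∑ s ∈ Finset.range N', (R s β).2 := by
      conv_lhs => rw [hN' N' le_rfl]
      exact Prod.snd_sum
    rw [h3]
    exact (norm_sum_le_of_le _ fun s _ => hpart s).trans (hsum N')
  -- The sup norm is not attained by the second coordinate, which is at most half of it, unless `β`
  -- is zero.
  have hβ1 : ‖β‖ ≤ ‖β.1‖ := by
    by_contra hlt
    have h3 : ‖β‖ = max ‖β.1‖ ‖β.2‖ := rfl
    rcases max_cases ‖β.1‖ ‖β.2‖ with h4 | h4
    · exact hlt (by rw [h3, h4.1])
    · have := norm_nonneg β.1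
      have : ‖β‖ = ‖β.2‖ := h3.trans h4.1
      linarith
  rw [hγβ]
  linarith [norm_nonneg β]

/-- The outcome of the auxiliary games gives that of the main game. -/
theorem hasSmallProjection [CompleteSpace Y] [CompleteSpace W]
    (H : InterleavedPlay y e J lab x κ η p q P Q ψ) {A : ℝ}
    (hA : 0 < A) (hW : WindowBound (interleavedBasis y e J) A)
    (hκ : ∀ j, κ j = (1 / 2) ^ (2 * j + 4) / A)
    (hlab : ∀ n, {k | lab k = n}.Infinite)
    (h : ∀ j, FirstLegal y p q j) (h' : ∀ j, AuxSecondLegal y e J lab x P Q τ j) {n : ℕ}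
    {B ε : ℝ}
    (hP : HasSmallProjection 𝕜 ((fun m => (x n m, (0 : W))) '' picked q n)
      (firstBlocks (fun i => P (turn lab n i))) B ε) :
    HasSmallProjection 𝕜 {a : Y | ∃ k ∈ picked q n, a = x n k}
      (firstBlocks p ∪ {a : Y | ∃ m, m ≠ n ∧ ∃ k ∈ picked q m, a = x m k}) B ε := by
  have h1 := hP.fst_image (H.norm_snd_le_norm_fst hA hW hκ hlab h h' n)
  convert h1 using 1
  · ext a
    simp only [Set.image_image, Set.mem_image, Set.mem_ofPred_eq, eq_comm]
  · rw [H.firstBlocks_aux hlab]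
    ext a
    constructor
    · rintro (⟨j, hj⟩ | ⟨m, hm, k, ⟨j, rfl, hk⟩, rfl⟩)
      · exact ⟨(a, 0), ⟨j, Or.inl ⟨a, hj, rfl⟩⟩, rfl⟩
      · rw [H.label] at hm ⊢
        rw [H.indices] at hk
        exact ⟨ψ j k, ⟨j, Or.inr ⟨hm, k, hk, rfl⟩⟩, ((H.lift_of_legal (h' j)).1 k hk).1⟩
    · rintro ⟨_, ⟨j, ⟨b, hb, rfl⟩ | ⟨hj, m, hm, rfl⟩⟩, rfl⟩
      · exact Or.inl ⟨j, hb⟩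
      · refine Or.inr ⟨lab j, hj, m, ⟨j, H.label j, by rwa [H.indices]⟩, ?_⟩
        exact ((H.lift_of_legal (h' j)).1 m hm).1

end InterleavedPlay

/-! ### Combining the auxiliary strategies -/

section Strategy

/-- Answers to finite lists can be defined by recursion on the answers given before. -/
theorem exists_run {α R : Type*} (d : R) (step : ℕ → (ℕ → R) → α → R) :
    ∃ run : List α → R, ∀ (p : ℕ → α) (k : ℕ),
      run ((List.range (k + 1)).map p) =
        step k (fun j => if j < k then run ((List.range (j + 1)).map p) else d) (p k) := by
  classical
  -- The recursion is on the turn number, with earlier answers read off initial segments of the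
  -- list; the default `d` fills the entries that do not exist yet.
  suffices h : ∃ F : ℕ → List α → R, ∀ k l, F k l =
      if h : l = [] then d
      else step k (fun j => if j < k then F j (l.take (j + 1)) else d) (l.getLast h) by
    obtain ⟨F, hF⟩ := h
    refine ⟨fun l => F (l.length - 1) l, fun p k => ?_⟩
    beta_reduce
    rw [hF, dif_neg (by simp)]
    have h1 : ((List.range (k + 1)).map p).length - 1 = k := by simp
    rw [h1]
    congr 1
    · ext1 j
      by_cases hj : j < k
      · rw [if_pos hj, if_pos hj, ← List.map_take, List.take_range, min_eq_left (by omega)]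
        simp
      · rw [if_neg hj, if_neg hj]
    · simp [List.range_succ]
  refine ⟨fun k => Nat.strongRec (motive := fun _ => List α → R) (fun k ih l =>
      if h : l = [] then d
      else step k (fun j => if hj : j < k then ih j hj (l.take (j + 1)) else d) (l.getLast h)) k,
    fun k l => ?_⟩
  beta_reduce
  rw [Nat.strongRec_eq]
  simp only [dite_eq_ite]

variable {𝕜 : Type*} [RCLike 𝕜]
variable {Y : Type*} [NormedAddCommGroup Y] [NormedSpace 𝕜 Y]
variable {W : Type*} [NormedAddCommGroup W] [NormedSpace 𝕜 W]

/-- Gives an accuracy for the lifts such that finitely many known functionals do not notice their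
second coordinates. -/
theorem exists_small_factor (F : Finset (StrongDual 𝕜 Y × ℝ)) {κ : ℝ} (hκ : 0 < κ) :
    ∃ η : ℝ, 0 < η ∧ η ≤ κ ∧ ∀ t ∈ F, 0 < t.2 → ‖t.1‖ * η ≤ t.2 * κ := by
  classical
  induction F using Finset.induction_on with
  | empty => exact ⟨κ, hκ, le_rfl, by simp⟩
  | insert t F _ ih =>
    obtain ⟨η, h0, h1, h2⟩ := ih
    by_cases ht : 0 < t.2
    · have h3 : 0 < t.2 * κ / (‖t.1‖ + 1) := by positivity
      refine ⟨min η (t.2 * κ / (‖t.1‖ + 1)), lt_min h0 h3, (min_le_left _ _).trans h1, ?_⟩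
      intro t' ht' hpos
      rcases Finset.mem_insert.1 ht' with rfl | ht'
      · calc ‖t'.1‖ * min η (t'.2 * κ / (‖t'.1‖ + 1)) ≤
              (‖t'.1‖ + 1) * (t'.2 * κ / (‖t'.1‖ + 1)) :=
              mul_le_mul (by linarith) (min_le_right _ _) (lt_min h0 h3).le (by positivity)
          _ = t'.2 * κ := by field_simp
      · exact (mul_le_mul_of_nonneg_left (min_le_left _ _) (norm_nonneg _)).trans (h2 t' ht' hpos)
    · refine ⟨η, h0, h1, fun t' ht' hpos => ?_⟩
      rcases Finset.mem_insert.1 ht' with rfl | ht'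
      · exact absurd hpos ht
      · exact h2 t' ht' hpos

/-- All that happens on one turn of an interleaved play. -/
structure TurnRecord (𝕜 Y W : Type*) [RCLike 𝕜] [NormedAddCommGroup Y] [NormedSpace 𝕜 Y]
    [NormedAddCommGroup W] [NormedSpace 𝕜 W] where
  first : FirstMove 𝕜 Y
  auxFirst : FirstMove 𝕜 (Y × W)
  auxSecond : SecondMove Unit 𝕜 (Y × W)
  lift : ℕ → Y × W
  second : SecondMove ℕ 𝕜 Y

/-- Strategies for the auxiliary games are combined to a strategy for the main game. -/
theorem exists_interleavedPlay (y : SchauderBasis 𝕜 Y) (e : SchauderBasis 𝕜 W) (J : W →L[𝕜] Y)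
    (lab : ℕ → ℕ) (hlab : ∀ n, {k | lab k = n}.Infinite) (x : ℕ → ℕ → Y) (κ : ℕ → ℝ)
    (hκ : ∀ k, 0 < κ k)
    (hlift : ∀ (n i : ℕ) (η : ℝ), 0 < η → ∃ ρ : ℝ, 0 < ρ ∧ ∀ M : Finset ℕ,
      (∀ b ∈ Submodule.span 𝕜 (x n '' M), b ≠ 0 → ∀ j < i, ‖y.coord j b‖ < ρ * ‖b‖) →
      ∃ (ψ : ℕ → Y × W) (l : ℕ),
        (∀ m ∈ M, (ψ m).1 = x n m ∧ ψ m ∈ blockSpan (interleavedBasis y e J) (2 * i) (2 * l)) ∧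
        ∀ β ∈ Submodule.span 𝕜 (ψ '' M), ‖β.2‖ ≤ η * ‖β.1‖)
    (σ : ℕ → List (FirstMove 𝕜 (Y × W)) → SecondMove Unit 𝕜 (Y × W)) :
    ∃ s : List (FirstMove 𝕜 Y) → SecondMove ℕ 𝕜 Y, ∀ p : ℕ → FirstMove 𝕜 Y,
      ∃ (P : ℕ → FirstMove 𝕜 (Y × W)) (Q : ℕ → SecondMove Unit 𝕜 (Y × W))
        (ψ : ℕ → ℕ → Y × W) (η : ℕ → ℝ),
        InterleavedPlay y e J lab x κ η p (respond s p) P Q ψ ∧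
        ∀ n, respond (σ n) (fun i => P (turn lab n i)) = fun i => Q (turn lab n i) := by
  classical
  choose! ρ hρ hlift using hlift
  choose! ψ l hψ hψ' using hlift
  choose η hη0 hηκ hη using fun (k : ℕ) (F : Finset (StrongDual 𝕜 (Y × W) × ℝ)) =>
    exists_small_factor F (hκ k)
  let prev : ℕ → (ℕ → TurnRecord 𝕜 Y W) → Finset (StrongDual 𝕜 (Y × W) × ℝ) :=
    fun k g => (Finset.range k).biUnion fun j => (g j).auxSecond.tests
  let aux₁ : ℕ → (ℕ → TurnRecord 𝕜 Y W) → FirstMove 𝕜 Y → FirstMove 𝕜 (Y × W) := fun k g a =>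
    { cut := 2 * a.cut
      tests := a.tests.image (fun t => (t.1.comp (.fst 𝕜 Y W), t.2)) ∪
        -- These coordinate tests make the heads of the next picked vectors small, as the lifting
        -- requires.
        (Finset.range a.cut).image (fun i => ((y.coord i).comp (.fst 𝕜 Y W),
          ρ (lab k) a.cut (η k (prev k g)))) ∪
        (prev k g).image (fun t => ((t.1.comp (.inl 𝕜 Y W)).comp (.fst 𝕜 Y W), t.2 * κ k))
      blocks := ((Finset.range k).filter (fun j => Fresh lab j k)).biUnion (fun j =>
          (g j).first.blocks.image (fun b => (b, 0)) ∪
          (g j).auxSecond.indices.image (g j).lift) ∪ a.blocks.image (fun b => (b, 0)) }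
  let aux₂ : ℕ → (ℕ → TurnRecord 𝕜 Y W) → FirstMove 𝕜 Y → SecondMove Unit 𝕜 (Y × W) :=
    fun k g a => σ (lab k)
      (((List.range k).filter (fun j => lab j = lab k)).map (fun j => (g j).auxFirst) ++
        [aux₁ k g a])
  let step : ℕ → (ℕ → TurnRecord 𝕜 Y W) → FirstMove 𝕜 Y → TurnRecord 𝕜 Y W := fun k g a =>
    { first := a
      auxFirst := aux₁ k g a
      auxSecond := aux₂ k g a
      lift := ψ (lab k) a.cut (η k (prev k g)) (aux₂ k g a).indices
      second :=
        { label := lab k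
          -- The integer must pass the move of the first player, the auxiliary blocks and the end of
          -- the lifts.
          cut := max (a.cut + 1) (max (aux₂ k g a).cut
            (l (lab k) a.cut (η k (prev k g)) (aux₂ k g a).indices))
          indices := (aux₂ k g a).indices
          approx := fun m => ((aux₂ k g a).approx m).1 - J ((aux₂ k g a).approx m).2
          tests := (prev k g ∪ (aux₂ k g a).tests).image
            (fun t => (t.1.comp (.inl 𝕜 Y W), t.2 * κ (k + 1))) } }
  let d : TurnRecord 𝕜 Y W :=
    { first := ⟨0, ∅, ∅⟩, auxFirst := ⟨0, ∅, ∅⟩, auxSecond := ⟨(), 0, ∅, 0, ∅⟩, lift := 0,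
      second := ⟨0, 0, ∅, 0, ∅⟩ }
  obtain ⟨run, hrun⟩ := exists_run d step
  refine ⟨fun hist => (run hist).second, fun p => ?_⟩
  let R : ℕ → TurnRecord 𝕜 Y W := fun k => run ((List.range (k + 1)).map p)
  let g : ℕ → ℕ → TurnRecord 𝕜 Y W := fun k j => if j < k then R j else d
  have hR : ∀ k, R k = step k (g k) (p k) := fun k => hrun p k
  have hg : ∀ k, ∀ j < k, g k j = R j := fun k j hj => if_pos hj
  have hfirst : ∀ k, (R k).first = p k := fun k => by rw [hR]
  have hprev : ∀ k t, t ∈ prev k (g k) ↔ ∃ j < k, t ∈ (R j).auxSecond.tests := fun k t => by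
    simp only [prev, Finset.mem_biUnion, Finset.mem_range]
    exact exists_congr fun j => and_congr_right fun hj => by rw [hg k j hj]
  have hq : respond (fun hist => (run hist).second) p = fun k => (R k).second := rfl
  have haux₁ : ∀ k, (R k).auxFirst = aux₁ k (g k) (p k) := fun k => by rw [hR]
  have haux₂ : ∀ k, (R k).auxSecond = aux₂ k (g k) (p k) := fun k => by rw [hR]
  have hlift' : ∀ k, (R k).lift =
      ψ (lab k) (p k).cut (η k (prev k (g k))) (R k).auxSecond.indices := fun k => by
    rw [haux₂, hR]
  have hcut : ∀ k, (R k).second.cut = max ((p k).cut + 1) (max (R k).auxSecond.cut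
      (l (lab k) (p k).cut (η k (prev k (g k))) (R k).auxSecond.indices)) := fun k => by
    rw [haux₂, hR]
  refine ⟨fun k => (R k).auxFirst, fun k => (R k).auxSecond, fun k => (R k).lift,
    fun k => η k (prev k (g k)), ?_, fun n => ?_⟩
  · rw [hq]
    constructor
    · intro k
      rw [hR]
    · intro k
      rw [hcut]
      omega
    · intro k
      rw [hcut]
      omega
    · intro k
      rw [haux₂, hR]
    · intro k m
      rw [haux₂, hR]
    · intro k t
      have h1 : (R k).second.tests = (prev k (g k) ∪ (R k).auxSecond.tests).image
          (fun t => (t.1.comp (.inl 𝕜 Y W), t.2 * κ (k + 1))) := by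
        rw [haux₂, hR]
      rw [h1]
      simp only [Finset.mem_image, Finset.mem_union, hprev]
      constructor
      · rintro ⟨t', ⟨j, hj, ht'⟩ | ht', rfl⟩
        · exact ⟨j, hj.le, t', ht', rfl⟩
        · exact ⟨k, le_rfl, t', ht', rfl⟩
      · rintro ⟨j, hj, t', ht', rfl⟩
        rcases hj.lt_or_eq with hlt | rfl
        · exact ⟨t', Or.inl ⟨j, hlt, ht'⟩, rfl⟩
        · exact ⟨t', Or.inr ht', rfl⟩
    · intro k
      rw [haux₁]
    · intro k h1 h2 t ht
      rw [haux₁] at ht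
      simp only [aux₁, Finset.mem_union, Finset.mem_image, hprev] at ht
      rcases ht with (⟨t', ht', rfl⟩ | ⟨i, hi, rfl⟩) | ⟨t', ⟨j, hj, ht'⟩, rfl⟩
      · exact h1 t' ht'
      · exact hρ _ _ _ (hη0 _ _)
      · exact mul_pos (h2 j hj t' ht') (hκ k)
    · intro k t ht
      rw [haux₁]
      exact Finset.mem_union_left _ (Finset.mem_union_left _ (Finset.mem_image_of_mem _ ht))
    · intro k j hj t ht
      rw [haux₁]
      exact Finset.mem_union_right _ (Finset.mem_image.2 ⟨t, (hprev k t).2 ⟨j, hj, ht⟩, rfl⟩)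
    · intro k b
      rw [haux₁]
      simp only [aux₁, Finset.mem_union, Finset.mem_biUnion, Finset.mem_filter, Finset.mem_range,
        Finset.mem_image]
      constructor
      · rintro (⟨j, ⟨hj, hf⟩, h⟩ | ⟨b', hb', rfl⟩)
        · rw [hg k j hj, hfirst] at h
          rcases h with ⟨b', hb', rfl⟩ | ⟨m, hm, rfl⟩
          · exact ⟨j, hj.le, hf, Or.inl ⟨b', hb', rfl⟩⟩
          · exact ⟨j, hj.le, hf, Or.inr ⟨hj, m, hm, rfl⟩⟩
        · exact ⟨k, le_rfl, fun i hi hi' => by omega, Or.inl ⟨b', hb', rfl⟩⟩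
      · rintro ⟨j, hj, hf, ⟨b', hb', rfl⟩ | ⟨hlt, m, hm, rfl⟩⟩
        · rcases hj.lt_or_eq with hlt | rfl
          · refine Or.inl ⟨j, ⟨hlt, hf⟩, Or.inl ⟨b', ?_, rfl⟩⟩
            rwa [hg k j hlt, hfirst]
          · exact Or.inr ⟨b', hb', rfl⟩
        · refine Or.inl ⟨j, ⟨hlt, hf⟩, Or.inr ⟨m, ?_, ?_⟩⟩
          · rwa [hg k j hlt]
          · rw [hg k j hlt]
    · intro k h
      have h1 : ∀ b ∈ Submodule.span 𝕜 (x (lab k) '' (R k).auxSecond.indices), b ≠ 0 →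
          ∀ j < (p k).cut,
            ‖y.coord j b‖ < ρ (lab k) (p k).cut (η k (prev k (g k))) * ‖b‖ := by
        intro b hb hb0 j hj
        refine h b hb hb0 ((y.coord j).comp (.fst 𝕜 Y W), _) ?_
        rw [haux₁]
        exact Finset.mem_union_left _ (Finset.mem_union_right _
          (Finset.mem_image.2 ⟨j, Finset.mem_range.2 hj, rfl⟩))
      rw [hlift']
      refine ⟨fun m hm => ?_, hψ' _ _ _ (hη0 _ _) _ h1⟩
      obtain ⟨h2, h3⟩ := hψ _ _ _ (hη0 _ _) _ h1 m hm
      refine ⟨h2, blockSpan_mono _ le_rfl ?_ h3⟩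
      rw [hcut]
      omega
    · exact fun k => (hη0 _ _).le
    · exact fun k => hηκ _ _
    · exact fun k j hj t ht ht0 => hη _ _ t ((hprev k t).2 ⟨j, hj, ht⟩) ht0
  · ext1 i
    set k := turn lab n i with hk
    have hn : lab k = n := Nat.nth_mem_of_infinite (hlab n) i
    have hi : turnCount lab n k = i := Nat.count_nth_of_infinite (hlab n) i
    beta_reduce
    rw [haux₂, respond, List.range_succ, List.map_append]
    simp only [aux₂, hn]
    congr 1
    congr 1
    · conv_lhs => rw [← hi]
      rw [← map_filter_range lab n k (fun j => (R j).auxFirst)]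
      refine List.map_congr_left fun j hj => ?_
      rw [hg k j (List.mem_range.1 (List.mem_filter.1 hj).1)]
    · rw [List.map_singleton, ← hk, haux₁]

end Strategy

/-! ### A silent first player, and the blocks of a completed game -/

section Blocks

variable {𝕜 : Type*} [RCLike 𝕜]
variable {Y : Type*} [NormedAddCommGroup Y] [NormedSpace 𝕜 Y] {ι : Type*}

/-- Against any strategy the first player can obey the rules without choosing any vectors. -/
theorem exists_idle_play (y : SchauderBasis 𝕜 Y)
    (σ : List (FirstMove 𝕜 Y) → SecondMove ι 𝕜 Y) :
    ∃ p : ℕ → FirstMove 𝕜 Y, (∀ k, FirstLegal y p (respond σ p) k) ∧ firstBlocks p = ∅ := by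
  -- The integer repeats the last one of the second player, which depends on the history; so moves
  -- and history are built together.
  let move : ℕ → List (FirstMove 𝕜 Y) → FirstMove 𝕜 Y :=
    fun k h => ⟨if k = 0 then 0 else (σ h).cut, ∅, ∅⟩
  let hist : ℕ → List (FirstMove 𝕜 Y) := fun k => Nat.rec [] (fun k h => h ++ [move k h]) k
  let p : ℕ → FirstMove 𝕜 Y := fun k => move k (hist k)
  have hhist : ∀ k, (List.range k).map p = hist k := fun k => by
    induction k with
    | zero => rfl
    | succ k ih => rw [List.range_succ, List.map_append, ih]; rfl
  refine ⟨p, fun k => ⟨?_, fun t ht => ?_, fun b hb => ?_, fun b hb hb0 => ?_⟩, ?_⟩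
  · rcases k with _ | k
    · exact le_rfl
    · change (σ _).cut ≤ (σ (hist (k + 1))).cut
      rw [hhist]
  · exact absurd ht (Finset.notMem_empty t)
  · exact absurd hb (Finset.notMem_empty b)
  · exact absurd (by simpa [p, move] using hb) hb0
  · ext b
    simp [firstBlocks, p, move]

variable {y : SchauderBasis 𝕜 Y} {x : ι → ℕ → Y} {τ : ℕ → ℝ} {p : ℕ → FirstMove 𝕜 Y}
  {q : ℕ → SecondMove ι 𝕜 Y}

theorem cut_le_cut_of_lt (hp : ∀ k, FirstLegal y p q k) (hq : ∀ k, SecondLegal y x τ p q k)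
    {j k : ℕ} (hjk : j < k) : (q j).cut ≤ (p k).cut := by
  induction k with
  | zero => omega
  | succ k ih =>
    refine le_trans ?_ (hp (k + 1)).cut_le
    rcases Nat.lt_succ_iff_lt_or_eq.1 hjk with hlt | rfl
    · exact (ih hlt).trans (hq k).cut_lt.le
    · exact le_rfl

theorem precedes_of_lt (hp : ∀ k, FirstLegal y p q k) (hq : ∀ k, SecondLegal y x τ p q k)
    {j k m m' : ℕ} (hjk : j < k) (hm : m ∈ (q j).indices) (hm' : m' ∈ (q k).indices) :
    Precedes y ((q j).approx m) ((q k).approx m') := by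
  intro i hi i' hi'
  have h1 := basisSupport_subset_of_mem_blockSpan y ((hq j).approx_mem m hm) hi
  have h2 := basisSupport_subset_of_mem_blockSpan y ((hq k).approx_mem m' hm') hi'
  exact h1.2.trans_le ((cut_le_cut_of_lt hp hq hjk).trans h2.1)

theorem disjoint_of_precedes {w w' : Y} (h : Precedes y w w') :
    Disjoint (basisSupport y w) (basisSupport y w') :=
  Set.disjoint_left.2 fun i hi hi' => lt_irrefl i (h i hi i hi')

/-- The blocks chosen by the second player in a completed game, arranged by labels. -/
theorem exists_blocks (hp : ∀ k, FirstLegal y p q k) (hq : ∀ k, SecondLegal y x τ p q k) :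
    ∃ w : ι → ℕ → Y,
      (∀ n, ∀ φ : ℕ → ℕ, StrictMono φ → Set.range φ = picked q n →
        IsBlockSequence y (fun k => w n (φ k))) ∧
      (∀ m n, m ≠ n → ∀ j ∈ picked q m, ∀ k ∈ picked q n,
        Disjoint (basisSupport y (w m j)) (basisSupport y (w n k))) ∧
      ∀ s : Finset (ι × ℕ), (∀ i ∈ s, i.2 ∈ picked q i.1) →
        ∃ N, ∑ i ∈ s, ‖x i.1 i.2 - w i.1 i.2‖ ≤ ∑ k ∈ Finset.range N, τ k := by
  classical
  have hturn : ∀ n m, ∃ k, m ∈ picked q n → (q k).label = n ∧ m ∈ (q k).indices := fun n m => by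
    by_cases h : m ∈ picked q n
    · obtain ⟨k, hk⟩ := h
      exact ⟨k, fun _ => hk⟩
    · exact ⟨0, fun h' => absurd h' h⟩
  choose κ hκ using hturn
  refine ⟨fun n m => (q (κ n m)).approx m, fun n φ hφ hrange => ⟨fun i => ?_, fun i j hij => ?_⟩,
    fun m n hmn j hj k hk => ?_, fun s hs => ?_⟩
  · have hi := hκ n (φ i) (hrange ▸ ⟨i, rfl⟩)
    exact ⟨_, _, (hq _).approx_mem _ hi.2⟩
  · have hi := hκ n (φ i) (hrange ▸ ⟨i, rfl⟩)
    have hj := hκ n (φ j) (hrange ▸ ⟨j, rfl⟩)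
    rcases lt_trichotomy (κ n (φ i)) (κ n (φ j)) with hlt | heq | hlt
    · exact precedes_of_lt hp hq hlt hi.2 hj.2
    · beta_reduce
      rw [heq] at hi ⊢
      exact (hq _).approx_successive _ hi.2 _ hj.2 (hφ hij)
    · exact absurd ((hq _).indices_gt _ hlt (hj.1.trans hi.1.symm) _ hj.2 _ hi.2)
        (hφ hij).le.not_gt
  · have hj' := hκ m j hj
    have hk' := hκ n k hk
    rcases lt_trichotomy (κ m j) (κ n k) with hlt | heq | hlt
    · exact disjoint_of_precedes (precedes_of_lt hp hq hlt hj'.2 hk'.2)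
    · exact absurd (hj'.1.symm.trans ((congrArg (fun k => (q k).label) heq).trans hk'.1)) hmn
    · exact (disjoint_of_precedes (precedes_of_lt hp hq hlt hk'.2 hj'.2)).symm
  · refine ⟨s.sup (fun i => κ i.1 i.2) + 1, ?_⟩
    -- Grouping the errors by turn bounds each group by the tolerance of its turn.
    rw [← Finset.sum_fiberwise_of_maps_to (t := Finset.range (s.sup (fun i => κ i.1 i.2) + 1))
      (g := fun i => κ i.1 i.2) (fun i hi => Finset.mem_range.2
        (Nat.lt_succ_of_le (Finset.le_sup (f := fun i : ι × ℕ => κ i.1 i.2) hi)))]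
    refine Finset.sum_le_sum fun k _ => le_trans ?_ (hq k).approx_close.le
    have hmem : ∀ i ∈ s.filter (fun i => κ i.1 i.2 = k),
        (q k).label = i.1 ∧ i.2 ∈ (q k).indices := fun i hi => by
      obtain ⟨h1, rfl⟩ := Finset.mem_filter.1 hi
      exact hκ _ _ (hs i h1)
    have hinj : Set.InjOn Prod.snd (s.filter (fun i => κ i.1 i.2 = k) : Set (ι × ℕ)) :=
      fun i hi i' hi' h => Prod.ext ((hmem i hi).1.symm.trans (hmem i' hi').1) h
    calc ∑ i ∈ s.filter (fun i => κ i.1 i.2 = k), ‖x i.1 i.2 - (q (κ i.1 i.2)).approx i.2‖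
        = ∑ i ∈ s.filter (fun i => κ i.1 i.2 = k), ‖x (q k).label i.2 - (q k).approx i.2‖ :=
          Finset.sum_congr rfl fun i hi => by
            rw [(hmem i hi).1, (Finset.mem_filter.1 hi).2]
      _ = ∑ m ∈ (s.filter (fun i => κ i.1 i.2 = k)).image Prod.snd,
            ‖x (q k).label m - (q k).approx m‖ :=
          (Finset.sum_image (f := fun m => ‖x (q k).label m - (q k).approx m‖) hinj).symm
      _ ≤ _ := Finset.sum_le_sum_of_subset_of_nonneg (fun m hm => by
            obtain ⟨i, hi, rfl⟩ := Finset.mem_image.1 hm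
            exact (hmem i hi).2) fun _ _ _ => norm_nonneg _

end Blocks

/-! ### Assembling the theorem -/

/-- The constant in a small projection can be enlarged. -/
theorem HasSmallProjection.mono {𝕜 : Type*} [RCLike 𝕜] {Y : Type*} [NormedAddCommGroup Y]
    [NormedSpace 𝕜 Y] {V A : Set Y} {B B' ε : ℝ} (h : HasSmallProjection 𝕜 V A B ε)
    (hB : 0 ≤ B → B ≤ B') : HasSmallProjection 𝕜 V A B' ε := by
  obtain ⟨P, h1, h2, h3, h4⟩ := h
  exact ⟨P, h1, h2, h3.trans (hB ((norm_nonneg P).trans h3)), h4⟩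

/-- The second player wins the game with all the sequences `T n (z n m)`. -/
theorem exists_interleaved_strategy {𝕜 : Type*} [RCLike 𝕜]
    {Z : ℕ → Type u} [∀ n, NormedAddCommGroup (Z n)] [∀ n, NormedSpace 𝕜 (Z n)]
    {Y : Type v} [NormedAddCommGroup Y] [NormedSpace 𝕜 Y] [CompleteSpace Y]
    (C D K : ℝ)
    (z : ∀ n, SchauderBasis 𝕜 (Z n))
    (hz : ∀ n, ComplementablySubseqReproducible.{u, v} D C (z n))
    (y : SchauderBasis 𝕜 Y)
    (E : ℕ → Submodule 𝕜 Y) (T : ∀ n, Z n ≃L[𝕜] E n)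
    (hTinv : ∀ n, ‖((T n).symm : E n →L[𝕜] Z n)‖ ≤ 1)
    (hT : ∀ n, ‖(T n : Z n →L[𝕜] E n)‖ ≤ K)
    (ε : ℝ) (hε : 0 < ε) (τ : ℕ → ℝ) (hτ : ∀ k, 0 < τ k) :
    ∃ σ : List (FirstMove 𝕜 Y) → SecondMove ℕ 𝕜 Y,
      IsWinningStrategy y (fun n m => (T n (z n m) : Y)) τ
        (fun p q => ∀ n,
          SubseqEquivalent C (z n) (picked q n) ∧
          HasSmallProjection 𝕜 {a : Y | ∃ k ∈ picked q n, a = (T n (z n k) : Y)}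
            (firstBlocks p ∪ {a : Y | ∃ m, m ≠ n ∧ ∃ k ∈ picked q m, a = (T m (z m k) : Y)})
            (K * D) ε)
        σ := by
  obtain ⟨W, _, _, _, e, c, hc, hJ⟩ := exists_absolute_basis y
  set x : ℕ → ℕ → Y := fun n m => (T n (z n m) : Y) with hx
  have hS : (Set.range y ∪ Set.range (fun i : ℕ × ℕ × ℕ =>
      x i.1 i.2.1 - SchauderBasis.proj y i.2.2 (x i.1 i.2.1))).Countable :=
    (Set.countable_range _).union (Set.countable_range _)
  obtain ⟨a, ha1, ha⟩ := exists_recurrent_normalized (𝕜 := 𝕜) hS ⟨y 0, Or.inl ⟨0, rfl⟩⟩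
  obtain ⟨J, hJ⟩ := hJ a ha1
  simp only [← hJ] at ha
  obtain ⟨A, hA, hW⟩ := exists_windowBound (interleavedBasis y e J)
  let lab : ℕ → ℕ := fun k => (Nat.unpair k).1
  have hlab : ∀ n, {k | lab k = n}.Infinite := fun n =>
    Set.infinite_of_forall_exists_gt fun k => ⟨Nat.pair n (k + 1),
      by simp [lab], (Nat.lt_succ_self k).trans_le (Nat.right_le_pair _ _)⟩
  let κ : ℕ → ℝ := fun j => (1 / 2) ^ (2 * j + 4) / A
  have hf : ∀ n (s : Finset ℕ) (r : ℕ → 𝕜), ∀ m ∈ s, ‖r m‖ ≤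
      -- The coefficient bound comes from the biorthogonal functionals of the basis pulled back
      -- along `T n`.
      ‖(z n).coord m‖ * ‖((T n).symm : E n →L[𝕜] Z n)‖ * ‖∑ j ∈ s, r j • x n j‖ := by
    intro n s r m hm
    have h1 : (z n).coord m ((T n).symm (∑ j ∈ s, r j • T n (z n j))) = r m := by
      simp only [map_sum, map_smul, ContinuousLinearEquiv.symm_apply_apply]
      rw [Finset.sum_eq_single_of_mem m hm fun j _ hj => by
        rw [basis_coord_ne (z n) hj.symm, smul_zero], basis_coord_self, smul_eq_mul, mul_one]
    have h2 : ‖∑ j ∈ s, r j • x n j‖ = ‖∑ j ∈ s, r j • T n (z n j)‖ := by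
      have h3 : ((∑ j ∈ s, r j • T n (z n j) : E n) : Y) = ∑ j ∈ s, r j • x n j := by simp [hx]
      rw [← h3]
      rfl
    rw [h2, mul_assoc]
    calc ‖r m‖ = ‖(z n).coord m ((T n).symm (∑ j ∈ s, r j • T n (z n j)))‖ := by rw [h1]
      _ ≤ _ := ((z n).coord m).le_opNorm _
      _ ≤ _ := mul_le_mul_of_nonneg_left
        (((T n).symm : E n →L[𝕜] Z n).le_opNorm _) (norm_nonneg _)
  let ι : ∀ n, E n →ₗᵢ[𝕜] Y × W := fun n =>
    { toLinearMap := (LinearMap.inl 𝕜 Y W).comp (E n).subtype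
      norm_map' := fun v => by simp [Prod.norm_def] }
  let T' : ∀ n, Z n ≃L[𝕜] LinearMap.range (ι n).toLinearMap := fun n =>
    (T n).trans (ι n).equivRange.toContinuousLinearEquiv
  have hT' : ∀ n v, (T' n v : Y × W) = ((T n v : Y), 0) := fun n v => rfl
  have hT'n : ∀ n, ‖(T' n : Z n →L[𝕜] LinearMap.range (ι n).toLinearMap)‖ ≤ K := fun n => by
    refine ContinuousLinearMap.opNorm_le_bound _ ((norm_nonneg _).trans (hT n)) fun v => ?_
    exact ((ι n).equivRange.norm_map (T n v)).trans_le
      ((T n : Z n →L[𝕜] E n).le_of_opNorm_le (hT n) v)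
  have hT'i : ∀ n, ‖((T' n).symm : LinearMap.range (ι n).toLinearMap →L[𝕜] Z n)‖ ≤ 1 := fun n => by
    refine ContinuousLinearMap.opNorm_le_bound _ zero_le_one fun v => ?_
    refine (((T n).symm : E n →L[𝕜] Z n).le_of_opNorm_le (hTinv n)
      ((ι n).equivRange.symm v)).trans_eq ?_
    rw [(ι n).equivRange.symm.norm_map]
  have hpos : ∀ n, 0 < ‖(T' n : Z n →L[𝕜] LinearMap.range (ι n).toLinearMap)‖ *
      ‖((T' n).symm : LinearMap.range (ι n).toLinearMap →L[𝕜] Z n)‖ := fun n => by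
    have : Nontrivial (Z n) := ⟨⟨z n 0, 0, basis_ne_zero (z n) 0⟩⟩
    exact mul_pos (T' n).norm_pos (T' n).norm_symm_pos
  -- Entry `0` governs the projection; entry `i + 1` is the tolerance of the `i`-th turn with label
  -- `n`, divided by the cost of the shear.
  have hτ' : ∀ n i, 0 < Nat.casesOn (motive := fun _ => ℝ) i ε
      (fun i => τ (turn lab n i) / (1 + ‖J‖)) := fun n i => by
    rcases i with _ | i
    · exact hε
    · exact div_pos (hτ _) (by positivity)
  choose σ hσ using fun n => hz n (Y × W) (interleavedBasis y e J) _ (T' n) _ (hτ' n)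
  obtain ⟨s, hs⟩ := exists_interleavedPlay y e J lab hlab x κ (fun k => by positivity)
    (fun n => exists_lift y e J hc (x n) _ (hf n) (fun i N => ha _ (Or.inl ⟨i, rfl⟩) N)
      (fun m l N => ha _ (Or.inr ⟨(n, m, l), rfl⟩) N)) σ
  refine ⟨s, fun p => ?_⟩
  obtain ⟨P, Q, ψ, η, H, hQ⟩ := hs p
  have hwin : ∀ n, _ := fun n => hσ n (fun i => P (turn lab n i))
  simp only [hQ, hT'] at hwin
  have hlegal : ∀ k, (∀ j ≤ k, FirstLegal y p (respond s p) j) →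
      InterleavedPlay.AuxFirstLegal y e J lab P Q k ∧
      InterleavedPlay.AuxSecondLegal y e J lab x P Q
        (fun n i => τ (turn lab n i) / (1 + ‖J‖)) k := fun k hk =>
    H.auxLegal hA hW (fun _ => rfl) (fun n => (hwin n).1) hk
  refine ⟨fun k hk => ?_, fun hk n => ?_⟩
  · refine H.secondLegal hA (fun _ => rfl) (fun k => ?_) fun j hj =>
      (hlegal j fun i hi => hk i (hi.trans hj)).2
    rw [turn_turnCount]
    exact (mul_div_cancel₀ _ (by positivity)).le
  · have hout := (hwin n).2 fun i => by
      have h1 := (hlegal (turn lab n i) fun j _ => hk j).1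
      have hn : lab (turn lab n i) = n := Nat.nth_mem_of_infinite (hlab n) i
      have hi : turnCount lab n (turn lab n i) = i := Nat.count_nth_of_infinite (hlab n) i
      rwa [InterleavedPlay.AuxFirstLegal, hn, hi] at h1
    rw [H.picked_aux hlab] at hout
    refine ⟨hout.1, H.hasSmallProjection hA hW (fun _ => rfl) hlab hk
      (fun j => (hlegal j fun i _ => hk i).2) (hout.2.mono fun h0 => ?_)⟩
    -- The sign of `D` is not given; it follows from the existence of one projection, as the norms
    -- of `T' n` and its inverse are positive.
    have hD : 0 ≤ D := nonneg_of_mul_nonneg_right h0 (hpos n)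
    refine mul_le_mul_of_nonneg_right ?_ hD
    exact (mul_le_mul (hT'n n) (hT'i n) (ContinuousLinearMap.opNorm_nonneg _)
      ((norm_nonneg _).trans (hT n))).trans_eq (mul_one K)

theorem corollary2p6 {𝕜 : Type*} [RCLike 𝕜]
    {Z : ℕ → Type u} [∀ n, NormedAddCommGroup (Z n)] [∀ n, NormedSpace 𝕜 (Z n)]
    [∀ n, CompleteSpace (Z n)]
    {Y : Type v} [NormedAddCommGroup Y] [NormedSpace 𝕜 Y] [CompleteSpace Y]
    (C D K : ℝ)
    (z : ∀ n, SchauderBasis 𝕜 (Z n))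
    (hz : ∀ n, ComplementablySubseqReproducible.{u, v} D C (z n))
    (y : SchauderBasis 𝕜 Y)
    (E : ℕ → Submodule 𝕜 Y) (T : ∀ n, Z n ≃L[𝕜] E n)
    (hTinv : ∀ n, ‖((T n).symm : E n →L[𝕜] Z n)‖ ≤ 1)
    (hT : ∀ n, ‖(T n : Z n →L[𝕜] E n)‖ ≤ K)
    (ε : ℝ) (hε : 0 < ε) :
    -- the subsequences, the blocks and the projections
    (∃ (M : ℕ → Set ℕ) (w : ℕ → ℕ → Y),
      (∀ n, ∃ φ : ℕ → ℕ, StrictMono φ ∧ Set.range φ = M n ∧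
        SeqEquivalent 𝕜 C (fun k => z n (φ k)) (z n) ∧
        IsBlockSequence y (fun k => w n (φ k))) ∧
      (∀ m n, m ≠ n → ∀ j ∈ M m, ∀ k ∈ M n,
        Disjoint (basisSupport y (w m j)) (basisSupport y (w n k))) ∧
      (∀ s : Finset (ℕ × ℕ), (∀ i ∈ s, i.2 ∈ M i.1) →
        ∑ i ∈ s, ‖(T i.1 (z i.1 i.2) : Y) - w i.1 i.2‖ ≤ ε) ∧
      ∀ n, HasSmallProjection 𝕜 {a : Y | ∃ k ∈ M n, a = (T n (z n k) : Y)}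
        {a : Y | ∃ m, m ≠ n ∧ ∃ k ∈ M m, a = (T m (z m k) : Y)} (K * D) ε) ∧
    -- the subsequences are produced by a two-player game
    (∀ τ : ℕ → ℝ, (∀ k, 0 < τ k) →
      ∃ σ : List (FirstMove 𝕜 Y) → SecondMove ℕ 𝕜 Y,
        IsWinningStrategy y (fun n m => (T n (z n m) : Y)) τ
          (fun p q => ∀ n,
            SubseqEquivalent C (z n) (picked q n) ∧
            HasSmallProjection 𝕜 {a : Y | ∃ k ∈ picked q n, a = (T n (z n k) : Y)}
              (firstBlocks p ∪ {a : Y | ∃ m, m ≠ n ∧ ∃ k ∈ picked q m, a = (T m (z m k) : Y)})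
              (K * D) ε)
          σ) := by

  have hgame := fun τ hτ => exists_interleaved_strategy C D K z hz y E T hTinv hT ε hε τ hτ
  refine ⟨?_, hgame⟩
  -- The partial sums of these tolerances are at most `ε`.
  obtain ⟨σ, hσ⟩ := hgame (fun k => ε / 2 * (1 / 2) ^ k) fun k => by positivity
  obtain ⟨p, hp, hp0⟩ := exists_idle_play y σ
  have hout := (hσ p).2 hp
  obtain ⟨w, hw1, hw2, hw3⟩ := exists_blocks hp fun k => (hσ p).1 k fun j _ => hp j
  refine ⟨picked (respond σ p), w, fun n => ?_, hw2, fun s hs => ?_, fun n => ?_⟩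
  · obtain ⟨φ, hφ, hrange, heq⟩ := (hout n).1
    exact ⟨φ, hφ, hrange, heq, hw1 n φ hφ hrange⟩
  · obtain ⟨N, hN⟩ := hw3 s hs
    refine hN.trans ?_
    rw [← Finset.mul_sum]
    exact (mul_le_mul_of_nonneg_left (sum_geometric_two_le N) (by positivity)).trans_eq
      (div_mul_cancel₀ ε two_ne_zero)
  · have h := (hout n).2
    rwa [hp0, Set.empty_union] at h
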